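/- For $X>0$, an integer $q\ge 1$ and an integer $a$ coprime to $q$, put $$S(X,q,a)=\sum_{\substack{1\le n\le X\\ n\equiv a\ (\mathrm{mod}\ q)}}\mu^2(n),\qquad S_0(X,q)=\frac1{\varphi(q)}\sum_{\substack{1\le n\le X\\ (n,q)=1}}\mu^2(n),\qquad E(X,q,a)=S(X,q,a)-S_0(X,q),$$ where $\mu$ is the Möbius function and $\varphi$ is Euler's totient function. (1) For every $0<\gamma<\frac12$ there exists a constant $C(\gamma)$, depending only on $\gamma$, such that for every real $X>3$, every prime $q$ and every integer $a$ coprime to $q$, $$|E(X,q,a)|\le C(\gamma)\left(\frac{X^{1/3}(\log\log X)^{7/3}}{(\log X)^{1/6-\gamma/3}}+\frac{X(\log\log X)^2}{q(\log X)^{\gamma/2}}\right).$$ (2) Consequently, for every $\varepsilon>0$, as $X\to\infty$, $$S(X,q,a)\sim S_0(X,q)\sim\frac{6}{\pi^2}\left(1-\frac1{q^2}\right)^{-1}\frac Xq,$$ uniformly for primes $q\le X^{2/3}(\log X)^{1/6-\varepsilon}$ and integers $a$ coprime to $q$. That is, for all $\varepsilon,\delta>0$ there is $X_0$ such that for all $X\ge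 X_0$ and all such $q$ and $a$, $$|S(X,q,a)-S_0(X,q)|\le\delta\,S_0(X,q)\quad\text{and}\quad \left|S_0(X,q)-\frac{6}{\pi^2}\left(1-\frac1{q^2}\right)^{-1}\frac Xq\right|\le\delta\,\frac{6}{\pi^2}\left(1-\frac1{q^2}\right)^{-1}\frac Xq.$$ -/

import Mathlib

open scoped ArithmeticFunction.Moebius

/-- `∑ f(n)` over the positive integers `n ≤ X` with `n ≡ a (mod q)`. -/
noncomputable def progressionSum (f : ℕ → ℝ) (X : ℝ) (q : ℕ) (a : ℤ) : ℝ :=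
  ∑ n ∈ (Finset.Icc 1 ⌊X⌋₊).filter (fun n : ℕ => (n : ℤ) ≡ a [ZMOD (q : ℤ)]), f n

/-- `(1 / φ(q)) ∑ f(n)` over the positive integers `n ≤ X` coprime to `q`. -/
noncomputable def coprimeAverage (f : ℕ → ℝ) (X : ℝ) (q : ℕ) : ℝ :=
  1 / (Nat.totient q : ℝ) *
    ∑ n ∈ (Finset.Icc 1 ⌊X⌋₊).filter (fun n : ℕ => Nat.Coprime n q), f n

/-- The error term `E_f(X, q, a)`. -/
noncomputable def progressionError (f : ℕ → ℝ) (X : ℝ) (q : ℕ) (a : ℤ) : ℝ :=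
  progressionSum f X q a - coprimeAverage f X q

/-- The function `μ²`, the indicator function of the squarefree integers. -/
def moebiusSq (n : ℕ) : ℝ := ((μ n : ℤ) : ℝ) ^ 2

/-! Both parts follow from the stronger bound `exists_abs_progressionError_le`: E ≪ X^(1/3)/(log
X)^(1/6) + X^(5/6)/q, without γ or log log X.

Write μ²(n) = ∑ μ(d) over d² ∣ n. As q is prime, S₀ is the mean of S(X,q,b) over the nonzero classes
b, so E is a mean of differences S(X,q,a) − S(X,q,b). Each d ≤ D contributes at most 1 to a
difference. The d > D contribute at most the number of pairs (d,m) with m d² ≤ X and m d² ≡ α, for α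
= a and α = b (`abs_progressionError_le`). Among these, each m ≤ D leaves at most two classes for d,
which costs O(D + √(XD)/q). If q < X^(1/2), the choice D = X^(1/3) leaves no other pair. Otherwise D
= X^(1/3)/(log X)^(1/6), and what is left lies in a box d ≤ X^(1/3)(log X)^(1/12), m ≤ M =
X^(1/3)(log X)^(1/3).

In that box each m admits at most two d, which is too many by a power of log X.
`exists_card_squareMulSolutions_le` recovers it from the factorization of m. Let y ≍ (log X)^(1/2)
and z ≍ X^(1/120). Only O(My/log X) of the m have no prime factor in [y,z) (`card_freeOfPrimes_le`).
For the others m = sp with p in a dyadic interval [2^j,2^(j+1)), and Cauchy–Schwarz over s in s·pd²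
≡ α leads to the congruence pd² ≡ p'd'² (`card_bilinear_sq_le`). The case p = p' gives O(M/2^j),
which sums to O(M/y). For p ≠ p' the solutions lie on two lines modulo q, and a line meets a small
square at most once because p/p' is not a rational square; this saves a power of X. With these
choices My/log X, M/y and D all have the size X^(1/3)/(log X)^(1/6).

For the asymptotics, S₀ is evaluated by the same convolution, its constant being 1/L(2,χ₀) for the
principal character modulo q. -/

/-! ### Chebyshev and Mertens bounds; integers without prime factors in an interval -/

/-- Mertens' argument: sum Λ ∗ 1 = log up to N, replace ⌊N/d⌋ by N/d − 1, and pay for this with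
Chebyshev's ψ(N) = O(N). -/
theorem sum_vonMangoldt_div_le (N : ℕ) (hN : 1 ≤ N) :
    ∑ d ∈ Finset.Ioc 0 N, ArithmeticFunction.vonMangoldt d / d ≤ Real.log N + (Real.log 4 + 4) := by
  have hN0 : (0 : ℝ) < N := by exact_mod_cast hN
  have h1 := ArithmeticFunction.sum_Ioc_mul_zeta_eq_sum ArithmeticFunction.vonMangoldt N
  rw [ArithmeticFunction.vonMangoldt_mul_zeta] at h1
  have h2 : ∑ n ∈ Finset.Ioc 0 N, ArithmeticFunction.log n ≤ N * Real.log N := by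
    calc ∑ n ∈ Finset.Ioc 0 N, ArithmeticFunction.log n
        ≤ ∑ n ∈ Finset.Ioc 0 N, Real.log N := by
          refine Finset.sum_le_sum fun n hn => ?_
          rw [Finset.mem_Ioc] at hn
          rw [ArithmeticFunction.log_apply]
          exact Real.log_le_log (by exact_mod_cast hn.1) (by exact_mod_cast hn.2)
      _ = N * Real.log N := by simp
  have h3 : ∑ d ∈ Finset.Ioc 0 N, ArithmeticFunction.vonMangoldt d ≤ (Real.log 4 + 4) * N := by
    have := Chebyshev.psi_le_const_mul_self hN0.le
    rwa [Chebyshev.psi, Nat.floor_natCast] at this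
  have h4 : ∑ d ∈ Finset.Ioc 0 N, ArithmeticFunction.vonMangoldt d * ((N : ℝ) / d - 1)
      ≤ N * Real.log N := by
    rw [h1] at h2
    refine le_trans (Finset.sum_le_sum fun d hd => ?_) h2
    refine mul_le_mul_of_nonneg_left ?_ ArithmeticFunction.vonMangoldt_nonneg
    rw [← Nat.floor_div_eq_div (K := ℝ)]
    linarith [Nat.lt_floor_add_one ((N : ℝ) / d)]
  have h5 : ∑ d ∈ Finset.Ioc 0 N, ArithmeticFunction.vonMangoldt d * ((N : ℝ) / d - 1)
      = N * (∑ d ∈ Finset.Ioc 0 N, ArithmeticFunction.vonMangoldt d / d)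
        - ∑ d ∈ Finset.Ioc 0 N, ArithmeticFunction.vonMangoldt d := by
    rw [Finset.mul_sum, ← Finset.sum_sub_distrib]
    exact Finset.sum_congr rfl fun d _ => by ring
  have h6 : (N : ℝ) * (∑ d ∈ Finset.Ioc 0 N, ArithmeticFunction.vonMangoldt d / d)
      ≤ N * (Real.log N + (Real.log 4 + 4)) := by nlinarith
  exact le_of_mul_le_mul_left h6 hN0

theorem sum_primes_inv_le (N z : ℕ) (hN : 1 ≤ N) (hz : 2 ≤ z) :
    ∑ p ∈ (Finset.Ioc 0 N).filter (fun p => p.Prime ∧ z ≤ p), (1 : ℝ) / p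
      ≤ (Real.log N + (Real.log 4 + 4)) / Real.log z := by
  have hz0 : 0 < Real.log z := Real.log_pos (by exact_mod_cast hz)
  rw [le_div_iff₀ hz0, Finset.sum_mul]
  refine le_trans ?_ (sum_vonMangoldt_div_le N hN)
  refine le_trans (Finset.sum_le_sum fun p hp => ?_)
    (Finset.sum_le_sum_of_subset_of_nonneg (Finset.filter_subset
      (fun p => p.Prime ∧ z ≤ p) _) fun d _ _ => by
        have := ArithmeticFunction.vonMangoldt_nonneg (n := d); positivity)
  obtain ⟨-, hp1, hp2⟩ := Finset.mem_filter.1 hp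
  rw [ArithmeticFunction.vonMangoldt_apply_prime hp1, one_div_mul_eq_div]
  have : Real.log z ≤ Real.log p :=
    Real.log_le_log (by exact_mod_cast (by omega : 0 < z)) (by exact_mod_cast hp2)
  gcongr

/-- Over all integers from 2 on, the product of k/(k − 1) telescopes, and omitting factors only
lowers it. Applied to primes this loses a logarithm against Mertens, which is affordable because y
is only a power of log X. -/
theorem prod_range_filter_inv_le (P : ℕ → Prop) [DecidablePred P] (hP : ∀ n, P n → 2 ≤ n) (n : ℕ) :
    ∏ p ∈ (Finset.range (n + 2)).filter P, (1 - (1 : ℝ) / p)⁻¹ ≤ n + 1 := by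
  induction n with
  | zero =>
    rw [Finset.filter_false_of_mem]
    · simp
    · intro x hx hPx
      have := hP x hPx
      rw [Finset.mem_range] at hx
      omega
  | succ n ih =>
    rw [Finset.range_add_one, Finset.filter_insert]
    split_ifs with h
    · rw [Finset.prod_insert (by simp)]
      have h1 : (1 - (1 : ℝ) / ((n + 2 : ℕ) : ℝ))⁻¹ = (n + 2) / (n + 1) := by
        have : (n : ℝ) + 1 ≠ 0 := by positivity
        have : (n : ℝ) + 2 ≠ 0 := by positivity
        push_cast
        rw [inv_eq_iff_eq_inv, inv_div]
        field_simp
        ring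
      have h2 : n + 1 + 1 = n + 2 := rfl
      rw [h2, h1]
      calc ((n : ℝ) + 2) / (n + 1) * _ ≤ ((n : ℝ) + 2) / (n + 1) * (n + 1) := by gcongr
        _ = ((n + 1 : ℕ) : ℝ) + 1 := by
          have : (n : ℝ) + 1 ≠ 0 := by positivity
          field_simp
          push_cast
          ring
    · refine ih.trans ?_
      push_cast
      linarith

/-- `n` has no prime factor in `[y, z)`. -/
def FreeOfPrimes (y z n : ℕ) : Prop := ∀ p : ℕ, p.Prime → p ∣ n → p < y ∨ z ≤ p

theorem FreeOfPrimes.of_dvd {y z n d : ℕ} (h : FreeOfPrimes y z n) (hd : d ∣ n) :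
    FreeOfPrimes y z d := fun p hp hpd => h p hp (hpd.trans hd)

-- The sum is part of the Euler product over the primes p < y and z ≤ p ≤ N. The small primes
-- contribute at most y by telescoping, the large ones a bounded factor once log z ≍ log N.
open Classical in
theorem sum_inv_freeOfPrimes_le (N y z : ℕ) (hN : 1 ≤ N) (hy : 2 ≤ y) (hz : y ≤ z) :
    ∑ n ∈ (Finset.Ioc 0 N).filter (FreeOfPrimes y z), (1 : ℝ) / n
      ≤ y * Real.exp (2 * ((Real.log N + (Real.log 4 + 4)) / Real.log z)) := by
  set A := (Finset.Ioc 0 N).filter (fun p => p < y ∨ z ≤ p) with hA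
  let f : ℕ →* ℝ :=
    { toFun := fun n => 1 / (n : ℝ)
      map_one' := by simp
      map_mul' := fun a b => by push_cast; rw [one_div_mul_one_div] }
  have hf : ∀ n, f n = 1 / (n : ℝ) := fun n => rfl
  obtain ⟨hs1, hs2⟩ := EulerProduct.summable_and_hasSum_factoredNumbers_prod_filter_prime_geometric
    (f := f) (fun {p} hp => by
      rw [hf, Real.norm_of_nonneg (by positivity)]
      have : (1 : ℝ) < p := by exact_mod_cast hp.one_lt
      rw [div_lt_one (by linarith)]
      exact this) A
  have h1 : ∑ n ∈ (Finset.Ioc 0 N).filter (FreeOfPrimes y z), (1 : ℝ) / n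
      ≤ ∏ p ∈ A with p.Prime, (1 - f p)⁻¹ := by
    rw [← hs2.tsum_eq, ← Finset.sum_coe_sort]
    have hmem : ∀ n ∈ (Finset.Ioc 0 N).filter (FreeOfPrimes y z), n ∈ Nat.factoredNumbers A := by
      intro n hn
      rw [Finset.mem_filter, Finset.mem_Ioc] at hn
      rw [Nat.mem_factoredNumbers']
      intro p hp hpn
      rw [hA, Finset.mem_filter, Finset.mem_Ioc]
      exact ⟨⟨hp.pos, (Nat.le_of_dvd hn.1.1 hpn).trans hn.1.2⟩, hn.2 p hp hpn⟩
    let i : (Finset.Ioc 0 N).filter (FreeOfPrimes y z) → Nat.factoredNumbers A :=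
      fun n => ⟨n.1, hmem n.1 n.2⟩
    have hi : Function.Injective i := fun a b hab => by
      have : a.1 = b.1 := congrArg (fun t : Nat.factoredNumbers A => t.1) hab
      exact Subtype.ext this
    rw [← tsum_fintype (L := SummationFilter.unconditional _)]
    refine Summable.tsum_le_tsum_of_inj i hi (fun c _ => ?_) (fun c => ?_) (by exact Summable.of_finite) hs2.summable
    · rw [hf]; positivity
    · exact le_of_eq (hf _).symm
  refine h1.trans ?_
  -- Here `y - 2 + 2` is y, as 2 ≤ y; this shape matches `prod_range_filter_inv_le`.
  have h2 : (A.filter Nat.Prime) ⊆ ((Finset.range (y - 2 + 2)).filter Nat.Prime) ∪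
      ((Finset.Ioc 0 N).filter (fun p => p.Prime ∧ z ≤ p)) := by
    intro p hp
    simp only [hA, Finset.mem_filter, Finset.mem_union, Finset.mem_Ioc, Finset.mem_range] at hp ⊢
    rcases hp.1.2 with h | h
    · left; exact ⟨by omega, hp.2⟩
    · right; exact ⟨hp.1.1, hp.2, h⟩
  have hge : ∀ p : ℕ, p.Prime → (1 : ℝ) ≤ (1 - f p)⁻¹ := by
    intro p hp
    have h2 : (2 : ℝ) ≤ p := by exact_mod_cast hp.two_le
    have : (1 : ℝ) / p ≤ 1 / 2 := by gcongr
    have h0 : (0 : ℝ) ≤ 1 / p := by positivity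
    rw [hf]
    exact (one_le_inv₀ (by linarith)).2 (by linarith)
  have hdisj : Disjoint ((Finset.range (y - 2 + 2)).filter Nat.Prime)
      ((Finset.Ioc 0 N).filter (fun p => p.Prime ∧ z ≤ p)) := by
    rw [Finset.disjoint_left]
    intro p hp hp'
    simp only [Finset.mem_filter, Finset.mem_range] at hp hp'
    omega
  calc ∏ p ∈ A with p.Prime, (1 - f p)⁻¹
      ≤ ∏ p ∈ ((Finset.range (y - 2 + 2)).filter Nat.Prime) ∪
      ((Finset.Ioc 0 N).filter (fun p => p.Prime ∧ z ≤ p)), (1 - f p)⁻¹ := by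
        rw [← Finset.prod_sdiff h2]
        refine le_mul_of_one_le_left (Finset.prod_nonneg fun p hp => ?_)
          (Finset.prod_induction _ (fun t : ℝ => 1 ≤ t) (fun a b ha hb => one_le_mul_of_one_le_of_one_le ha hb) le_rfl fun p hp => ?_)
        · linarith [hge p (Finset.mem_filter.1 hp).2]
        · have := (Finset.mem_sdiff.1 hp).1
          refine hge p ?_
          rcases Finset.mem_union.1 this with h | h
          · exact (Finset.mem_filter.1 h).2
          · exact (Finset.mem_filter.1 h).2.1
    _ = (∏ p ∈ (Finset.range (y - 2 + 2)).filter Nat.Prime, (1 - f p)⁻¹) *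
        ∏ p ∈ (Finset.Ioc 0 N).filter (fun p => p.Prime ∧ z ≤ p), (1 - f p)⁻¹ :=
        Finset.prod_union hdisj
    _ ≤ y * Real.exp (2 * ((Real.log N + (Real.log 4 + 4)) / Real.log z)) := by
        refine mul_le_mul ?_ ?_ (Finset.prod_nonneg fun p hp => ?_) (by positivity)
        · refine (prod_range_filter_inv_le Nat.Prime (fun n hn => hn.two_le) (y - 2)).trans ?_
          have : ((y - 2 : ℕ) : ℝ) + 1 ≤ y := by
            exact_mod_cast (by omega : y - 2 + 1 ≤ y)
          exact this
        · calc ∏ p ∈ (Finset.Ioc 0 N).filter (fun p => p.Prime ∧ z ≤ p), (1 - f p)⁻¹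
              ≤ ∏ p ∈ (Finset.Ioc 0 N).filter (fun p => p.Prime ∧ z ≤ p), Real.exp (2 * (1 / p)) := by
                refine Finset.prod_le_prod (fun p hp => ?_) fun p hp => ?_
                · linarith [hge p (Finset.mem_filter.1 hp).2.1]
                · have hp1 := (Finset.mem_filter.1 hp).2.1
                  have h2 : (2 : ℝ) ≤ p := by exact_mod_cast hp1.two_le
                  have h3 : (1 : ℝ) / p ≤ 1 / 2 := by gcongr
                  have h0 : (0 : ℝ) ≤ 1 / p := by positivity
                  rw [hf]
                  -- For 0 ≤ x ≤ 1/2 one has 1/(1 − x) ≤ 1 + 2x ≤ exp(2x).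
                  refine le_trans ?_ (Real.add_one_le_exp _)
                  rw [inv_le_iff_one_le_mul₀ (by linarith)]
                  nlinarith
            _ = Real.exp (2 * ∑ p ∈ (Finset.Ioc 0 N).filter (fun p => p.Prime ∧ z ≤ p), (1 : ℝ) / p) := by
                rw [Finset.mul_sum, Real.exp_sum]
            _ ≤ _ := by
                gcongr
                exact sum_primes_inv_le N z hN (hy.trans hz)
        · linarith [hge p (Finset.mem_filter.1 hp).2.1]

-- A substitute for an upper-bound sieve. Integers above √N have log n ≥ (log N)/2, so it suffices
-- to bound ∑ log n. Expand log = 1 ∗ Λ: the cofactor of a free integer is free, and Chebyshev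
-- bounds the inner sum of Λ, leaving the harmonic sum above.
open Classical in
theorem card_freeOfPrimes_le (N y z : ℕ) (hN : 2 ≤ N) (hy : 2 ≤ y) (hz : y ≤ z) :
    (((Finset.Ioc 0 N).filter (FreeOfPrimes y z)).card : ℝ)
      ≤ Real.sqrt N + 2 / Real.log N * ((Real.log 4 + 4) * N *
        (y * Real.exp (2 * ((Real.log N + (Real.log 4 + 4)) / Real.log z)))) := by
  set F := (Finset.Ioc 0 N).filter (FreeOfPrimes y z) with hF
  have hlog : 0 < Real.log N := Real.log_pos (by exact_mod_cast hN)
  have hC : 0 ≤ Real.log 4 + 4 := by have := Real.log_nonneg (by norm_num : (1 : ℝ) ≤ 4); linarith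
  have hmain : ∑ n ∈ F, Real.log n ≤ (Real.log 4 + 4) * N *
        (y * Real.exp (2 * ((Real.log N + (Real.log 4 + 4)) / Real.log z))) := by
    let g : ArithmeticFunction ℝ :=
      ⟨fun n => if n ≠ 0 ∧ FreeOfPrimes y z n then 1 else 0, by simp⟩
    have hg : ∀ n, g n = if n ≠ 0 ∧ FreeOfPrimes y z n then 1 else 0 := fun n => rfl
    -- All divisors of a free n are free, so every coefficient of g in (g ∗ Λ)(n) is 1 and the value
    -- is log n; at other n the convolution is nonnegative.
    have h1 : ∑ n ∈ F, Real.log n ≤ ∑ n ∈ Finset.Ioc 0 N, (g * ArithmeticFunction.vonMangoldt) n := by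
      rw [hF, Finset.sum_filter]
      refine Finset.sum_le_sum fun n hn => ?_
      have hn0 : n ≠ 0 := by rw [Finset.mem_Ioc] at hn; omega
      rw [ArithmeticFunction.mul_apply]
      split_ifs with h
      · rw [← ArithmeticFunction.log_apply, ← ArithmeticFunction.zeta_mul_vonMangoldt,
          ArithmeticFunction.mul_apply]
        refine le_of_eq (Finset.sum_congr rfl fun x hx => ?_)
        have hx' := Nat.mem_divisorsAntidiagonal.1 hx
        have hx0 : x.1 ≠ 0 := by rintro h0; rw [h0] at hx'; simp at hx'; omega
        rw [hg, if_pos ⟨hx0, h.of_dvd ⟨x.2, hx'.1.symm⟩⟩]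
        simp [hx0]
      · refine Finset.sum_nonneg fun x _ => mul_nonneg ?_ ArithmeticFunction.vonMangoldt_nonneg
        rw [hg]; split_ifs <;> norm_num
    refine h1.trans ?_
    rw [ArithmeticFunction.sum_Ioc_mul_eq_sum_sum]
    calc ∑ n ∈ Finset.Ioc 0 N, g n * ∑ m ∈ Finset.Ioc 0 (N / n), ArithmeticFunction.vonMangoldt m
        ≤ ∑ n ∈ Finset.Ioc 0 N, g n * ((Real.log 4 + 4) * (N / n)) := by
          refine Finset.sum_le_sum fun n _ => mul_le_mul_of_nonneg_left ?_ ?_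
          · have := Chebyshev.psi_le_const_mul_self (x := (N : ℝ) / n) (by positivity)
            rwa [Chebyshev.psi, Nat.floor_div_eq_div] at this
          · rw [hg]; split_ifs <;> norm_num
      _ = (Real.log 4 + 4) * N * ∑ n ∈ F, (1 : ℝ) / n := by
          rw [hF, Finset.sum_filter, Finset.mul_sum]
          refine Finset.sum_congr rfl fun n hn => ?_
          have hn0 : n ≠ 0 := by rw [Finset.mem_Ioc] at hn; omega
          rw [hg]
          simp only [ne_eq, hn0, not_false_eq_true, true_and]
          split_ifs <;> ring
      _ ≤ _ := by
          gcongr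
          exact sum_inv_freeOfPrimes_le N y z (by omega) hy hz
  have hsplit : (F.card : ℝ) ≤ Real.sqrt N + 2 / Real.log N * ∑ n ∈ F, Real.log n := by
    have h1 : (F.card : ℝ) = (F.filter (fun n => n ≤ Nat.sqrt N)).card
        + (F.filter (fun n => ¬ n ≤ Nat.sqrt N)).card := by
      rw [← Finset.card_filter_add_card_filter_not (fun n => n ≤ Nat.sqrt N)]
      push_cast; rfl
    have h2 : ((F.filter (fun n => n ≤ Nat.sqrt N)).card : ℝ) ≤ Real.sqrt N := by
      have : (F.filter (fun n => n ≤ Nat.sqrt N)).card ≤ Nat.sqrt N := by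
        refine (Finset.card_le_card (t := Finset.Ioc 0 (Nat.sqrt N)) ?_).trans (by simp)
        intro n hn
        simp only [hF, Finset.mem_filter, Finset.mem_Ioc] at hn ⊢
        exact ⟨hn.1.1.1, hn.2⟩
      exact (Nat.cast_le.2 this).trans Real.nat_sqrt_le_real_sqrt
    have h3 : ((F.filter (fun n => ¬ n ≤ Nat.sqrt N)).card : ℝ)
        ≤ 2 / Real.log N * ∑ n ∈ F, Real.log n := by
      rw [Finset.card_eq_sum_ones, Nat.cast_sum, Finset.mul_sum]
      refine le_trans (Finset.sum_le_sum fun n hn => ?_)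
        (Finset.sum_le_sum_of_subset_of_nonneg (Finset.filter_subset _ _) fun n hn _ => ?_)
      · have hn2 := (Finset.mem_filter.1 hn).2
        have : N ≤ n ^ 2 := by rw [not_le, Nat.sqrt_lt'] at hn2; exact hn2.le
        have h5 : Real.log N ≤ 2 * Real.log n := by
          rw [← Nat.cast_ofNat (R := ℝ) (n := 2), ← Real.log_pow]
          exact Real.log_le_log (by exact_mod_cast (by omega : 0 < N)) (by exact_mod_cast this)
        rw [div_mul_eq_mul_div, le_div_iff₀ hlog]
        simpa using h5
      · have := Real.log_natCast_nonneg n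
        positivity
    rw [h1]; linarith
  refine hsplit.trans ?_
  gcongr

/-! ### The congruence p x² ≡ p' y² and the bilinear count -/

/-- The p-adic valuation is odd on the left and even on the right unless both sides vanish. -/
theorem Nat.Prime.mul_sq_ne_mul_sq {p p' : ℕ} (hp : p.Prime) (hp' : p'.Prime) (hne : p ≠ p')
    {x y : ℕ} (h : p * x ^ 2 = p' * y ^ 2) : x = 0 ∧ y = 0 := by
  by_cases hx : x = 0
  · subst hx
    have : p' * y ^ 2 = 0 := by rw [← h]; simp
    have := hp'.pos
    refine ⟨rfl, ?_⟩
    simpa [hp'.ne_zero] using ‹p' * y ^ 2 = 0›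
  · exfalso
    have hy : y ≠ 0 := by
      rintro rfl
      simp [hp.ne_zero, hx] at h
    have := Fact.mk hp
    have h1 := congrArg (padicValNat p) h
    rw [padicValNat.mul hp.ne_zero (pow_ne_zero 2 hx), padicValNat.mul hp'.ne_zero (pow_ne_zero 2 hy),
      padicValNat.pow, padicValNat.pow, padicValNat.self hp.one_lt,
      padicValNat.eq_zero_of_not_dvd (fun hd => hne ((Nat.prime_dvd_prime_iff_eq hp hp').1 hd))] at h1
    omega

theorem card_sq_roots_le (q : ℕ) [Fact q.Prime] (β : ZMod q) :
    (Finset.univ.filter (fun x : ZMod q => x ^ 2 = β)).card ≤ 2 := by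
  by_cases h : ∃ r : ZMod q, r ^ 2 = β
  · obtain ⟨r, rfl⟩ := h
    refine (Finset.card_le_card (t := {r, -r}) fun x hx => ?_).trans Finset.card_le_two
    rw [Finset.mem_filter] at hx
    rw [Finset.mem_insert, Finset.mem_singleton]
    exact sq_eq_sq_iff_eq_or_eq_neg.1 hx.2
  · rw [Finset.filter_false_of_mem fun x _ hx => h ⟨x, hx⟩]
    simp

theorem card_sq_eq_le (q : ℕ) [Fact q.Prime] (β : ZMod q) (D : ℕ) :
    ((Finset.Icc 1 D).filter (fun d : ℕ => (d : ZMod q) ^ 2 = β)).card ≤ 2 * (D / q + 1) := by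
  have hq : 0 < q := (Fact.out : q.Prime).pos
  calc ((Finset.Icc 1 D).filter (fun d : ℕ => (d : ZMod q) ^ 2 = β)).card
      ≤ (Finset.univ.filter (fun x : ZMod q => x ^ 2 = β) ×ˢ Finset.range (D / q + 1)).card := by
        refine Finset.card_le_card_of_injOn (fun d : ℕ => ((d : ZMod q), d / q)) ?_ ?_
        · intro d hd
          simp only [Finset.coe_filter, Finset.mem_Icc, Set.mem_ofPred_eq] at hd
          simp only [Finset.coe_product, Set.mem_prod, Finset.mem_coe, Finset.mem_filter,
            Finset.mem_univ, true_and, Finset.mem_range]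
          exact ⟨hd.2, Nat.lt_succ_of_le (Nat.div_le_div_right hd.1.2)⟩
        · intro d _ e _ h
          simp only [Prod.mk.injEq] at h
          have h1 := (ZMod.natCast_eq_natCast_iff' d e q).1 h.1
          rw [← Nat.div_add_mod d q, ← Nat.div_add_mod e q, h.2, h1]
    _ ≤ 2 * (D / q + 1) := by
        rw [Finset.card_product, Finset.card_range]
        exact Nat.mul_le_mul_right _ (card_sq_roots_le q β)

/-- A short integer vector on the conic `p x² = p' y²` modulo `q` vanishes. -/
theorem eq_zero_of_mul_sq_eq {q p p' B Q : ℕ} (hp : p.Prime) (hp' : p'.Prime)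
    (hne : p ≠ p') (hpQ : p ≤ Q) (hpQ' : p' ≤ Q) (hB : Q * B ^ 2 ≤ q) {x y : ℤ}
    (hx : |x| < B) (hy : |y| < B)
    (h : (p : ZMod q) * (x : ZMod q) ^ 2 = p' * (y : ZMod q) ^ 2) : x = 0 ∧ y = 0 := by
  have hdvd : (q : ℤ) ∣ p * x ^ 2 - p' * y ^ 2 := by
    rw [← ZMod.intCast_zmod_eq_zero_iff_dvd]
    push_cast
    exact sub_eq_zero.2 h
  have hbound : ∀ (r : ℕ) (t : ℤ), 0 < r → r ≤ Q → |t| < B → 0 ≤ r * t ^ 2 ∧ (r : ℤ) * t ^ 2 < q := by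
    intro r t hr hrQ ht
    refine ⟨by positivity, ?_⟩
    have h1 : t ^ 2 < (B : ℤ) ^ 2 := by
      rw [← sq_abs t]
      exact pow_lt_pow_left₀ ht (abs_nonneg t) two_ne_zero
    have h2 : (r : ℤ) ≤ Q := by exact_mod_cast hrQ
    have h3 : (Q : ℤ) * B ^ 2 ≤ q := by exact_mod_cast hB
    have h4 : (0 : ℤ) < r := by exact_mod_cast hr
    nlinarith [sq_nonneg t]
  have h1 := hbound p x hp.pos hpQ hx
  have h2 := hbound p' y hp'.pos hpQ' hy
  -- Both terms lie in [0,q), so their difference is a multiple of q of absolute value less than q.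
  have h0 : (p : ℤ) * x ^ 2 - p' * y ^ 2 = 0 := by
    refine Int.eq_zero_of_abs_lt_dvd hdvd ?_
    rw [abs_lt]
    constructor <;> linarith [h1.1, h1.2, h2.1, h2.2]
  have h3 : p * x.natAbs ^ 2 = p' * y.natAbs ^ 2 := by
    zify
    rw [sq_abs, sq_abs]
    linarith
  have := hp.mul_sq_ne_mul_sq hp' hne h3
  exact ⟨Int.natAbs_eq_zero.1 this.1, Int.natAbs_eq_zero.1 this.2⟩

theorem Nat.abs_sub_lt_of_div_eq {a b B : ℕ} (hB : 0 < B) (h : a / B = b / B) :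
    |(a : ℤ) - b| < B := by
  have h1 := Nat.div_add_mod a B
  have h2 := Nat.div_add_mod b B
  have h3 := Nat.mod_lt a hB
  have h4 := Nat.mod_lt b hB
  rw [h] at h1
  rw [abs_lt]
  constructor <;> omega

/-- Relative to one solution e, all others lie on the two lines through 0 of slope ± e.2/e.1 modulo
q. Cut the box into squares of side B. Two solutions on one line and in one square differ by a short
vector on the same conic, which must be 0. -/
theorem card_mul_sq_eq_mul_sq_le {q p p' B Q D : ℕ} [Fact q.Prime] (hp : p.Prime) (hp' : p'.Prime)
    (hne : p ≠ p') (hpQ : p ≤ Q) (hpQ' : p' ≤ Q) (hB : Q * B ^ 2 ≤ q) (hB0 : 0 < B)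
    (hD : D < q) (hpq' : p' < q) :
    (((Finset.Icc 1 D) ×ˢ (Finset.Icc 1 D)).filter (fun t : ℕ × ℕ =>
      (p : ZMod q) * (t.1 : ZMod q) ^ 2 = p' * (t.2 : ZMod q) ^ 2)).card ≤ 2 * (D / B + 1) ^ 2 := by
  set R := ((Finset.Icc 1 D) ×ˢ (Finset.Icc 1 D)).filter (fun t : ℕ × ℕ =>
      (p : ZMod q) * (t.1 : ZMod q) ^ 2 = p' * (t.2 : ZMod q) ^ 2) with hR
  have hmem : ∀ t ∈ R, (1 ≤ t.1 ∧ t.1 ≤ D) ∧ (1 ≤ t.2 ∧ t.2 ≤ D) ∧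
      (p : ZMod q) * (t.1 : ZMod q) ^ 2 = p' * (t.2 : ZMod q) ^ 2 := by
    intro t ht
    simpa only [hR, Finset.mem_filter, Finset.mem_product, Finset.mem_Icc, and_assoc] using ht
  have hnz : ∀ n : ℕ, 1 ≤ n → n < q → (n : ZMod q) ≠ 0 := by
    intro n h1 h2 h
    rw [ZMod.natCast_eq_zero_iff] at h
    exact absurd (Nat.le_of_dvd h1 h) (by omega)
  rcases R.eq_empty_or_nonempty with h0 | ⟨e, he⟩
  · rw [h0]; simp
  have he' := hmem e he
  have he1 := hnz e.1 he'.1.1 (by omega)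
  have hp0 := hnz p' hp'.pos hpq'
  have hsign : ∀ t ∈ R, (t.2 : ZMod q) * e.1 = t.1 * e.2 ∨ (t.2 : ZMod q) * e.1 = -(t.1 * e.2) := by
    intro t ht
    have ht' := (hmem t ht).2.2
    rw [← sq_eq_sq_iff_eq_or_eq_neg]
    refine mul_left_cancel₀ hp0 ?_
    linear_combination (-(e.1 : ZMod q) ^ 2) * ht' + (t.1 : ZMod q) ^ 2 * he'.2.2
  classical
  -- The line and the square of side B containing t; these determine t.
  let φ : ℕ × ℕ → Bool × (ℕ × ℕ) := fun t =>
    (decide ((t.2 : ZMod q) * e.1 = t.1 * e.2), (t.1 / B, t.2 / B))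
  calc R.card ≤ ((Finset.univ : Finset Bool) ×ˢ
        (Finset.range (D / B + 1) ×ˢ Finset.range (D / B + 1))).card := by
        refine Finset.card_le_card_of_injOn φ ?_ ?_
        · intro t ht
          have ht' := hmem t ht
          simp only [Finset.coe_product, Set.mem_prod, Finset.mem_coe, Finset.mem_univ, true_and,
            Finset.mem_range, φ]
          exact ⟨Nat.lt_succ_of_le (Nat.div_le_div_right ht'.1.2),
            Nat.lt_succ_of_le (Nat.div_le_div_right ht'.2.1.2)⟩
        · intro t ht u hu h
          simp only [Prod.mk.injEq, φ, decide_eq_decide] at h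
          have key : ∃ s : ZMod q, s ^ 2 = 1 ∧
              ((t.2 : ZMod q) - u.2) * e.1 = s * ((t.1 - u.1) * e.2) := by
            by_cases hc : (t.2 : ZMod q) * e.1 = t.1 * e.2
            · exact ⟨1, by ring, by linear_combination hc - h.1.1 hc⟩
            · have h1 := (hsign t ht).resolve_left hc
              have h2 := (hsign u hu).resolve_left (fun hc' => hc (h.1.2 hc'))
              exact ⟨-1, by ring, by linear_combination h1 - h2⟩
          obtain ⟨s, hs, hk⟩ := key
          have hz := eq_zero_of_mul_sq_eq (q := q) hp hp' hne hpQ hpQ' hB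
            (Nat.abs_sub_lt_of_div_eq hB0 h.2.1) (Nat.abs_sub_lt_of_div_eq hB0 h.2.2) (by
              refine mul_right_cancel₀ (pow_ne_zero 2 he1) ?_
              push_cast
              have hk2 := congrArg (fun w => w ^ 2) hk
              simp only [mul_pow, hs, one_mul] at hk2
              linear_combination (((t.1 : ZMod q) - u.1) ^ 2) * he'.2.2 - (p' : ZMod q) * hk2)
          ext <;> omega
    _ = 2 * (D / B + 1) ^ 2 := by
        simp [Finset.card_product, sq]

/-- Cauchy–Schwarz over s, then a split of the pairs (p,d), (p',d') sharing the same s. The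
equal-prime part is bounded by the count itself, hence the count on both sides; the rest satisfies p
d² = p' d'² modulo q. -/
theorem card_bilinear_sq_le {q B Q D S : ℕ} [Fact q.Prime] {α : ZMod q} (hα : α ≠ 0)
    (P : Finset ℕ) (hP : ∀ p ∈ P, p.Prime ∧ p ≤ Q ∧ p < q) (hB : Q * B ^ 2 ≤ q) (hB0 : 0 < B)
    (hD : D < q) (hS : S < q) :
    (((Finset.Icc 1 S) ×ˢ (P ×ˢ Finset.Icc 1 D)).filter (fun t : ℕ × ℕ × ℕ =>
      (t.1 : ZMod q) * (t.2.1 * (t.2.2 : ZMod q) ^ 2) = α)).card ^ 2 ≤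
    S * (2 * (((Finset.Icc 1 S) ×ˢ (P ×ˢ Finset.Icc 1 D)).filter (fun t : ℕ × ℕ × ℕ =>
      (t.1 : ZMod q) * (t.2.1 * (t.2.2 : ZMod q) ^ 2) = α)).card
      + P.card ^ 2 * (2 * (D / B + 1) ^ 2)) := by
  set W := ((Finset.Icc 1 S) ×ˢ (P ×ˢ Finset.Icc 1 D)).filter (fun t : ℕ × ℕ × ℕ =>
      (t.1 : ZMod q) * (t.2.1 * (t.2.2 : ZMod q) ^ 2) = α) with hW
  let A : ℕ → Finset (ℕ × ℕ) := fun s => (P ×ˢ Finset.Icc 1 D).filter (fun t : ℕ × ℕ =>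
      (s : ZMod q) * (t.1 * (t.2 : ZMod q) ^ 2) = α)
  have hA : ∀ s t, t ∈ A s ↔ (t.1 ∈ P ∧ 1 ≤ t.2 ∧ t.2 ≤ D) ∧
      (s : ZMod q) * (t.1 * (t.2 : ZMod q) ^ 2) = α := by
    intro s t
    simp only [A, Finset.mem_filter, Finset.mem_product, Finset.mem_Icc]
  have hWA : W.card = ∑ s ∈ Finset.Icc 1 S, (A s).card := by
    rw [hW, Finset.card_filter, Finset.sum_product]
    exact Finset.sum_congr rfl fun s _ => (Finset.card_filter _ _).symm
  have hne : ∀ s t, t ∈ A s → (s : ZMod q) ≠ 0 ∧ (t.1 : ZMod q) * (t.2 : ZMod q) ^ 2 ≠ 0 := by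
    intro s t ht
    have h := ((hA s t).1 ht).2
    constructor
    · intro h0; rw [h0, zero_mul] at h; exact hα h.symm
    · intro h0; rw [h0, mul_zero] at h; exact hα h.symm
  classical
  let G : ℕ → Finset ((ℕ × ℕ) × (ℕ × ℕ)) := fun s =>
    (A s ×ˢ A s).filter (fun w => ¬ w.1.1 = w.2.1)
  -- Cancelling s and p leaves d'² = d², and D < q allows at most two such d'.
  have hdiag : ∀ s, ((A s ×ˢ A s).filter (fun w => w.1.1 = w.2.1)).card ≤ 2 * (A s).card := by
    intro s
    refine Finset.card_le_mul_card_image_of_maps_to (f := Prod.fst) (fun w hw => ?_) 2 fun t ht => ?_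
    · exact (Finset.mem_product.1 (Finset.mem_filter.1 hw).1).1
    · have h2 := card_sq_eq_le q ((t.2 : ZMod q) ^ 2) D
      rw [Nat.div_eq_of_lt hD] at h2
      refine le_trans (Finset.card_le_card_of_injOn (fun w => w.2.2) ?_ ?_) h2
      · intro w hw
        simp only [Finset.coe_filter, Finset.mem_filter, Finset.mem_product, Set.mem_ofPred_eq] at hw
        obtain ⟨⟨⟨hw1, hw2⟩, hw3⟩, rfl⟩ := hw
        have e1 := (hA _ _).1 hw1
        have e2 := (hA _ _).1 hw2
        simp only [Finset.coe_filter, Finset.mem_Icc, Set.mem_ofPred_eq]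
        refine ⟨e2.1.2, ?_⟩
        have hs := (hne s _ hw1).1
        have hp := left_ne_zero_of_mul (hne s _ hw1).2
        refine mul_left_cancel₀ (mul_ne_zero hs hp) ?_
        have e3 := e2.2
        rw [← hw3] at e3
        linear_combination e3 - e1.2
      · intro w hw v hv h
        simp only [Finset.coe_filter, Finset.mem_filter, Set.mem_ofPred_eq] at hw hv
        have h1 : w.1 = v.1 := hw.2.trans hv.2.symm
        refine Prod.ext h1 (Prod.ext ?_ h)
        rw [← hw.1.2, ← hv.1.2, h1]
  -- Since S < q, the value p d² determines s, so the sets `G s` are disjoint and the sum over s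
  -- costs nothing.
  have hoff : ∑ s ∈ Finset.Icc 1 S, (G s).card ≤ P.card ^ 2 * (2 * (D / B + 1) ^ 2) := by
    rw [← Finset.card_biUnion]
    · calc ((Finset.Icc 1 S).biUnion G).card
          ≤ (2 * (D / B + 1) ^ 2) * (P ×ˢ P).card := by
            refine Finset.card_le_mul_card_image_of_maps_to
              (f := fun w : (ℕ × ℕ) × (ℕ × ℕ) => (w.1.1, w.2.1)) (fun w hw => ?_) _ fun t ht => ?_
            · obtain ⟨s, -, hs⟩ := Finset.mem_biUnion.1 hw
              have := Finset.mem_product.1 (Finset.mem_filter.1 hs).1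
              exact Finset.mem_product.2 ⟨((hA _ _).1 this.1).1.1, ((hA _ _).1 this.2).1.1⟩
            · by_cases htt : t.1 = t.2
              · refine le_trans (le_of_eq ?_) (Nat.zero_le _)
                rw [Finset.card_eq_zero, Finset.filter_eq_empty_iff]
                rintro w hw rfl
                obtain ⟨s, -, hs⟩ := Finset.mem_biUnion.1 hw
                exact (Finset.mem_filter.1 hs).2 htt
              · have ht' := Finset.mem_product.1 ht
                have h1 := hP _ ht'.1
                have h2 := hP _ ht'.2
                refine le_trans (Finset.card_le_card_of_injOn (fun w => (w.1.2, w.2.2)) ?_ ?_)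
                  (card_mul_sq_eq_mul_sq_le (q := q) (p := t.1) (p' := t.2) (D := D) h1.1 h2.1 htt
                    h1.2.1 h2.2.1 hB hB0 hD h2.2.2)
                · intro w hw
                  simp only [Finset.coe_filter, Finset.mem_biUnion, Set.mem_ofPred_eq] at hw
                  obtain ⟨⟨s, -, hs⟩, rfl⟩ := hw
                  have h3 := Finset.mem_product.1 (Finset.mem_filter.1 hs).1
                  have e1 := (hA _ _).1 h3.1
                  have e2 := (hA _ _).1 h3.2
                  simp only [Finset.coe_filter, Finset.mem_product, Finset.mem_Icc, Set.mem_ofPred_eq]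
                  refine ⟨⟨e1.1.2, e2.1.2⟩, ?_⟩
                  exact mul_left_cancel₀ (hne s _ h3.1).1 (e1.2.trans e2.2.symm)
                · intro w hw v hv h
                  simp only [Finset.coe_filter, Set.mem_ofPred_eq] at hw hv
                  have h3 := hw.2.trans hv.2.symm
                  simp only [Prod.mk.injEq] at h h3
                  exact Prod.ext (Prod.ext h3.1 h.1) (Prod.ext h3.2 h.2)
        _ = P.card ^ 2 * (2 * (D / B + 1) ^ 2) := by
            rw [Finset.card_product]; ring
    · intro s hs s' hs' hss
      rw [Function.onFun, Finset.disjoint_left]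
      intro w hw hw'
      have h1 := (Finset.mem_product.1 (Finset.mem_filter.1 hw).1).1
      have h2 := (Finset.mem_product.1 (Finset.mem_filter.1 hw').1).1
      apply hss
      have h3 : (s : ZMod q) = s' := mul_right_cancel₀ (hne s _ h1).2
        (((hA _ _).1 h1).2.trans ((hA _ _).1 h2).2.symm)
      rw [ZMod.natCast_eq_natCast_iff'] at h3
      simp only [Finset.coe_Icc, Set.mem_Icc] at hs hs'
      rwa [Nat.mod_eq_of_lt (by omega), Nat.mod_eq_of_lt (by omega)] at h3
  calc W.card ^ 2 = (∑ s ∈ Finset.Icc 1 S, (A s).card) ^ 2 := by rw [hWA]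
    _ ≤ (Finset.Icc 1 S).card * ∑ s ∈ Finset.Icc 1 S, (A s).card ^ 2 := sq_sum_le_card_mul_sum_sq
    _ = S * ∑ s ∈ Finset.Icc 1 S, (((A s ×ˢ A s).filter (fun w => w.1.1 = w.2.1)).card + (G s).card) := by
        rw [Nat.card_Icc, Nat.add_sub_cancel]
        congr 1
        refine Finset.sum_congr rfl fun s _ => ?_
        rw [Finset.card_filter_add_card_filter_not, Finset.card_product, sq]
    _ ≤ S * (2 * W.card + P.card ^ 2 * (2 * (D / B + 1) ^ 2)) := by
        refine Nat.mul_le_mul_left _ ?_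
        rw [Finset.sum_add_distrib, hWA, Finset.mul_sum]
        exact Nat.add_le_add (Finset.sum_le_sum fun s _ => hdiag s) hoff

/-! ### Solutions of m d² ≡ α in a box -/

/-- The pairs `(d, m)` with `d ≤ D`, `m ≤ M` and `m d² = α` modulo `q`. -/
def squareMulSolutions (q D M : ℕ) (α : ZMod q) : Finset (ℕ × ℕ) :=
  ((Finset.Icc 1 D) ×ˢ (Finset.Icc 1 M)).filter (fun t : ℕ × ℕ =>
    (t.2 : ZMod q) * (t.1 : ZMod q) ^ 2 = α)

theorem mem_squareMulSolutions {q D M : ℕ} {α : ZMod q} {t : ℕ × ℕ} :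
    t ∈ squareMulSolutions q D M α ↔ ((1 ≤ t.1 ∧ t.1 ≤ D) ∧ (1 ≤ t.2 ∧ t.2 ≤ M)) ∧
      (t.2 : ZMod q) * (t.1 : ZMod q) ^ 2 = α := by
  simp only [squareMulSolutions, Finset.mem_filter, Finset.mem_product, Finset.mem_Icc]

/-- The primes in `[2^j, 2^(j+1))`. -/
def dyadicPrimes (j : ℕ) : Finset ℕ := (Finset.Ico (2 ^ j) (2 ^ (j + 1))).filter Nat.Prime

theorem card_dyadicPrimes_le (j : ℕ) : (dyadicPrimes j).card ≤ 2 ^ j := by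
  refine (Finset.card_filter_le _ _).trans ?_
  rw [Nat.card_Ico, pow_succ]
  omega

/-- The solutions with a prime factor from a dyadic interval split off `m`. -/
def dyadicSolutions (q D M j : ℕ) (α : ZMod q) : Finset (ℕ × ℕ × ℕ) :=
  ((Finset.Icc 1 (M / 2 ^ j)) ×ˢ (dyadicPrimes j ×ˢ Finset.Icc 1 D)).filter
    (fun t : ℕ × ℕ × ℕ => (t.1 : ZMod q) * (t.2.1 * (t.2.2 : ZMod q) ^ 2) = α)

-- When m is free of primes in the range, it has at most two d because D < q. Otherwise any prime
-- factor p in the range is split off and sorted by j = ⌊log₂ p⌋; the map back from (s,p,d) to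
-- (d,ps) shows that overcounting is harmless.
open Classical in
theorem card_squareMulSolutions_le {q D M j₀ j₁ : ℕ} [Fact q.Prime] {α : ZMod q} (hα : α ≠ 0)
    (hD : D < q) :
    (squareMulSolutions q D M α).card ≤
      2 * ((Finset.Ioc 0 M).filter (FreeOfPrimes (2 ^ j₀) (2 ^ j₁))).card
        + ∑ j ∈ Finset.Ico j₀ j₁, (dyadicSolutions q D M j α).card := by
  rw [← Finset.card_filter_add_card_filter_not (fun t : ℕ × ℕ => FreeOfPrimes (2 ^ j₀) (2 ^ j₁) t.2)]
  refine Nat.add_le_add ?_ ?_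
  · refine Finset.card_le_mul_card_image_of_maps_to (f := Prod.snd) (fun t ht => ?_) 2 fun m hm => ?_
    · rw [Finset.mem_filter, mem_squareMulSolutions] at ht
      rw [Finset.mem_filter, Finset.mem_Ioc]
      exact ⟨⟨ht.1.1.2.1, ht.1.1.2.2⟩, ht.2⟩
    · have h2 := card_sq_eq_le q (α / m) D
      rw [Nat.div_eq_of_lt hD] at h2
      refine le_trans (Finset.card_le_card_of_injOn Prod.fst ?_ ?_) h2
      · intro t ht
        simp only [Finset.coe_filter, Finset.mem_filter, mem_squareMulSolutions,
          Set.mem_ofPred_eq] at ht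
        obtain ⟨⟨⟨h3, h4⟩, -⟩, rfl⟩ := ht
        simp only [Finset.coe_filter, Finset.mem_Icc, Set.mem_ofPred_eq]
        refine ⟨h3.1, ?_⟩
        have hm0 : (t.2 : ZMod q) ≠ 0 := by
          intro h0
          rw [h0, zero_mul] at h4
          exact hα h4.symm
        rw [eq_div_iff hm0, mul_comm]
        exact h4
      · intro t ht u hu h
        simp only [Finset.coe_filter, Set.mem_ofPred_eq] at ht hu
        exact Prod.ext h (ht.2.trans hu.2.symm)
  · refine le_trans (Finset.card_le_card (t := (Finset.Ico j₀ j₁).biUnion fun j =>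
      (dyadicSolutions q D M j α).image fun t => (t.2.2, t.2.1 * t.1)) ?_)
      (Finset.card_biUnion_le.trans (Finset.sum_le_sum fun j _ => Finset.card_image_le))
    intro t ht
    rw [Finset.mem_filter, mem_squareMulSolutions, FreeOfPrimes] at ht
    obtain ⟨⟨⟨hd, hm⟩, heq⟩, hfree⟩ := ht
    push Not at hfree
    obtain ⟨p, hp, hpm, hp1, hp2⟩ := hfree
    obtain ⟨s, hs⟩ := hpm
    have hl1 : 2 ^ Nat.log 2 p ≤ p := Nat.pow_log_le_self 2 hp.ne_zero
    have hl2 : p < 2 ^ (Nat.log 2 p + 1) := Nat.lt_pow_succ_log_self (by norm_num) p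
    have hj1 : j₀ ≤ Nat.log 2 p := Nat.le_log_of_pow_le (by norm_num) hp1
    have hj2 : Nat.log 2 p < j₁ := Nat.log_lt_of_lt_pow hp.ne_zero hp2
    have hs0 : 0 < s := by
      rcases Nat.eq_zero_or_pos s with h | h
      · rw [hs, h] at hm; omega
      · exact h
    rw [Finset.mem_biUnion]
    refine ⟨Nat.log 2 p, Finset.mem_Ico.2 ⟨hj1, hj2⟩, Finset.mem_image.2 ⟨(s, p, t.1), ?_, ?_⟩⟩
    · simp only [dyadicSolutions, dyadicPrimes, Finset.mem_filter, Finset.mem_product,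
        Finset.mem_Icc, Finset.mem_Ico]
      refine ⟨⟨⟨hs0, ?_⟩, ⟨⟨hl1, hl2⟩, hp⟩, hd⟩, ?_⟩
      · rw [Nat.le_div_iff_mul_le (by positivity), mul_comm]
        calc 2 ^ Nat.log 2 p * s ≤ p * s := Nat.mul_le_mul_right _ hl1
          _ ≤ M := by rw [← hs]; exact hm.2
      · rw [← heq, hs]
        push_cast
        ring
    · exact Prod.ext rfl hs.symm

theorem le_two_mul_add_sqrt {w a b : ℝ} (ha : 0 ≤ a) (hb : 0 ≤ b) (h : w ^ 2 ≤ a * (2 * w + b)) :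
    w ≤ 2 * a + Real.sqrt (a * b) := by
  have h1 := Real.sq_sqrt (mul_nonneg ha hb)
  have h2 := Real.sqrt_nonneg (a * b)
  by_contra! h3
  nlinarith

/-- Solves the quadratic inequality of `card_bilinear_sq_le`. The factor 1/2^j is kept only in the
diagonal term; the other term is small enough to be bounded uniformly in j. -/
theorem card_dyadicSolutions_le {q B D M j j₁ : ℕ} [Fact q.Prime] {α : ZMod q} (hα : α ≠ 0)
    (hj : j < j₁) (hB : 2 ^ j₁ * B ^ 2 ≤ q) (hB0 : 0 < B) (hz : 2 ^ j₁ < q)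
    (hD : D < q) (hM : M < q) :
    ((dyadicSolutions q D M j α).card : ℝ) ≤ 2 * ((M : ℝ) / 2 ^ j)
      + Real.sqrt (M * ((2 ^ j₁) ^ 2 * (2 * (D / B + 1) ^ 2))) := by
  have hpow : 2 ^ (j + 1) ≤ 2 ^ j₁ := Nat.pow_le_pow_right (by norm_num) hj
  have h := card_bilinear_sq_le (q := q) (B := B) (Q := 2 ^ j₁) (D := D) (S := M / 2 ^ j) hα
    (dyadicPrimes j) (fun p hp => by
      simp only [dyadicPrimes, Finset.mem_filter, Finset.mem_Ico] at hp
      exact ⟨hp.2, by omega, by omega⟩) hB hB0 hD ((Nat.div_le_self _ _).trans_lt hM)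
  change (dyadicSolutions q D M j α).card ^ 2 ≤ M / 2 ^ j * (2 * (dyadicSolutions q D M j α).card
      + (dyadicPrimes j).card ^ 2 * (2 * (D / B + 1) ^ 2)) at h
  have hS : ((M / 2 ^ j : ℕ) : ℝ) ≤ (M : ℝ) / 2 ^ j := by
    simpa using Nat.cast_div_le (α := ℝ) (m := M) (n := 2 ^ j)
  have hSM : (M : ℝ) / 2 ^ j ≤ M := div_le_self (by positivity) (one_le_pow₀ (by norm_num))
  have hDB : ((D / B : ℕ) : ℝ) ≤ (D : ℝ) / B := Nat.cast_div_le
  have hc : ((dyadicPrimes j).card : ℝ) ≤ 2 ^ j₁ := by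
    exact_mod_cast (card_dyadicPrimes_le j).trans (Nat.pow_le_pow_right (by norm_num) hj.le)
  have h' : ((dyadicSolutions q D M j α).card : ℝ) ^ 2 ≤ ((M / 2 ^ j : ℕ) : ℝ) *
      (2 * (dyadicSolutions q D M j α).card
      + ((dyadicPrimes j).card : ℝ) ^ 2 * (2 * (((D / B : ℕ) : ℝ) + 1) ^ 2)) := by exact_mod_cast h
  refine (le_two_mul_add_sqrt (a := (M : ℝ) / 2 ^ j) (b := (2 ^ j₁) ^ 2 * (2 * (D / B + 1) ^ 2))
    (by positivity) (by positivity) (h'.trans (by gcongr))).trans ?_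
  gcongr

theorem sum_Ico_inv_two_pow_le (j₀ j₁ : ℕ) : ∑ j ∈ Finset.Ico j₀ j₁, (1 : ℝ) / 2 ^ j ≤ 2 / 2 ^ j₀ := by
  rcases le_total j₁ j₀ with h | h
  · rw [Finset.Ico_eq_empty_of_le h, Finset.sum_empty]
    positivity
  · have : ∀ n, j₀ ≤ n → ∑ j ∈ Finset.Ico j₀ n, (1 : ℝ) / 2 ^ j = 2 / 2 ^ j₀ - 2 / 2 ^ n := by
      intro n hn
      induction n, hn using Nat.le_induction with
      | base => simp
      | succ n hn ih =>
        rw [Finset.sum_Ico_succ_top hn, ih, pow_succ]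
        field_simp
        ring
    rw [this j₁ h]
    have : (0 : ℝ) ≤ 2 / 2 ^ j₁ := by positivity
    linarith

/-- The parameters stand for u = X^(1/120) and l = (log X)^(1/12), so that fractional powers become
integral: u^40 = X^(1/3), l^12 = log X. The condition 4l⁶ ≤ u is what makes y ≤ z below. -/
theorem exists_card_squareMulSolutions_le :
    ∃ C : ℝ, ∀ u l : ℝ, 18 ≤ u → 1 ≤ l → 4 * l ^ 6 ≤ u → 120 * Real.log u = l ^ 12 →
      ∀ q : ℕ, q.Prime → u ^ 60 ≤ q → ∀ α : ZMod q, α ≠ 0 →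
        ((squareMulSolutions q ⌊u ^ 40 * l⌋₊ ⌊u ^ 40 * l ^ 4⌋₊ α).card : ℝ) ≤ C * (u ^ 40 / l ^ 2) := by
  set C₀ := Real.log 4 + 4 with hC₀
  have hC₀0 : 0 ≤ C₀ := by have := Real.log_nonneg (by norm_num : (1 : ℝ) ≤ 4); linarith
  refine ⟨2 * (1 + 480 * (C₀ * Real.exp (2 * (88 + 2 * C₀)))) + 5, ?_⟩
  intro u l hu hl hul hlog q hq huq α hα
  classical
  have := Fact.mk hq
  have hlu : l ≤ u := by nlinarith [le_self_pow₀ hl (by norm_num : 6 ≠ 0)]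
  have hu0 : 0 < u := by linarith
  have hu1 : 1 ≤ u := by linarith
  set D := ⌊u ^ 40 * l⌋₊ with hD
  set M := ⌊u ^ 40 * l ^ 4⌋₊ with hM
  have hDle : (D : ℝ) ≤ u ^ 40 * l := Nat.floor_le (by positivity)
  have hMle : (M : ℝ) ≤ u ^ 40 * l ^ 4 := Nat.floor_le (by positivity)
  have hMle' : (M : ℝ) ≤ u ^ 44 := by
    calc (M : ℝ) ≤ u ^ 40 * l ^ 4 := hMle
      _ ≤ u ^ 40 * u ^ 4 := by gcongr
      _ = u ^ 44 := by ring
  have hMge : u ≤ M := by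
    have h1 : u ^ 40 * l ^ 4 < M + 1 := Nat.lt_floor_add_one _
    have h2 : u ^ 2 ≤ u ^ 40 := pow_le_pow_right₀ hu1 (by norm_num)
    have h3 : u ^ 40 * 1 ≤ u ^ 40 * l ^ 4 := by gcongr; exact one_le_pow₀ hl
    nlinarith
  have hlt : ∀ (x : ℝ), x ≤ u ^ 44 → x < q := fun x hx =>
    (hx.trans_lt (pow_lt_pow_right₀ (by linarith) (by norm_num))).trans_le huq
  have hDq : D < q := by
    have : (D : ℝ) < q := hlt _ <| by
      calc (D : ℝ) ≤ u ^ 40 * l := hDle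
        _ ≤ u ^ 40 * u ^ 4 := by
          gcongr
          exact hlu.trans (le_self_pow₀ hu1 (by norm_num))
        _ = u ^ 44 := by ring
    exact_mod_cast this
  have hMq : M < q := by exact_mod_cast hlt _ hMle'
  -- Thus z = 2^j₁ lies in (u/2, u], and y = 2^(n+1) in (l⁶, 2l⁶].
  obtain ⟨j₁, hj1, hj2⟩ := exists_nat_pow_near hu1 (by norm_num : (1 : ℝ) < 2)
  obtain ⟨n, hn1, hn2⟩ := exists_nat_pow_near (one_le_pow₀ hl : 1 ≤ l ^ 6) (by norm_num : (1 : ℝ) < 2)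
  have hy2 : (2 : ℝ) ^ (n + 1) ≤ 2 * l ^ 6 := by rw [pow_succ]; linarith
  have hyz : (2 : ℝ) ^ (n + 1) ≤ 2 ^ j₁ := by
    rw [pow_succ (2 : ℝ) j₁] at hj2; linarith
  have hyz' : 2 ^ (n + 1) ≤ 2 ^ j₁ := by exact_mod_cast hyz
  have hzq : 2 ^ j₁ < q := by
    have : (2 : ℝ) ^ j₁ < q := hlt _ (hj1.trans (le_self_pow₀ hu1 (by norm_num)))
    exact_mod_cast this
  -- Then z B² ≤ u^57 ≤ q, while D/B ≪ u^12 l makes the off-diagonal term about u^34, well below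
  -- u^40.
  set B := ⌊u ^ 28⌋₊ with hBdef
  have hBle : (B : ℝ) ≤ u ^ 28 := Nat.floor_le (by positivity)
  have hBge : u ^ 28 / 2 ≤ B := by
    have h1 : u ^ 28 < B + 1 := Nat.lt_floor_add_one _
    have h2 : u ≤ u ^ 28 := le_self_pow₀ hu1 (by norm_num)
    linarith
  have hBpos : (0 : ℝ) < B := lt_of_lt_of_le (by positivity) hBge
  have hB : 2 ^ j₁ * B ^ 2 ≤ q := by
    have : (2 : ℝ) ^ j₁ * B ^ 2 ≤ q := by
      calc (2 : ℝ) ^ j₁ * B ^ 2 ≤ u * (u ^ 28) ^ 2 := by gcongr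
        _ = u ^ 57 := by ring
        _ ≤ u ^ 60 := pow_le_pow_right₀ hu1 (by norm_num)
        _ ≤ q := huq
    exact_mod_cast this
  have hlogu : 1 ≤ Real.log u := by
    rw [Real.le_log_iff_exp_le hu0]
    linarith [Real.exp_one_lt_d9]
  have hcount := card_squareMulSolutions_le (D := D) (M := M) (j₀ := n + 1) (j₁ := j₁) hα hDq
  have hM2 : 2 ≤ M := by
    have : (2 : ℝ) ≤ M := by linarith
    exact_mod_cast this
  have hfree := card_freeOfPrimes_le M (2 ^ (n + 1)) (2 ^ j₁) hM2
    (by rw [pow_succ]; have := Nat.one_le_two_pow (n := n); omega) hyz'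
  have hlogM : Real.log u ≤ Real.log M := Real.log_le_log hu0 hMge
  have hlogM' : Real.log M ≤ 44 * Real.log u := by
    have := Real.log_le_log (by linarith) hMle'
    rwa [Real.log_pow] at this
  have hlogz : Real.log u / 2 ≤ Real.log ((2 ^ j₁ : ℕ) : ℝ) := by
    have h1 : u ≤ ((2 : ℝ) ^ j₁) ^ 2 := by
      rw [pow_succ (2 : ℝ) j₁] at hj2
      nlinarith
    have h2 := Real.log_le_log hu0 h1
    rw [Real.log_pow] at h2
    push_cast at h2 ⊢
    linarith
  have hl0 : 0 < l := by linarith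
  have hfree' : (((Finset.Ioc 0 M).filter (FreeOfPrimes (2 ^ (n + 1)) (2 ^ j₁))).card : ℝ)
      ≤ (1 + 480 * (C₀ * Real.exp (2 * (88 + 2 * C₀)))) * (u ^ 40 / l ^ 2) := by
    refine hfree.trans ?_
    have h1 : Real.sqrt M ≤ u ^ 40 / l ^ 2 := by
      rw [Real.sqrt_le_iff]
      refine ⟨by positivity, hMle.trans ?_⟩
      rw [div_pow, le_div_iff₀ (by positivity)]
      calc u ^ 40 * l ^ 4 * (l ^ 2) ^ 2 = u ^ 40 * l ^ 8 := by ring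
        _ ≤ u ^ 40 * u ^ 8 := by gcongr
        _ ≤ u ^ 40 * u ^ 40 := by gcongr; norm_num
        _ = (u ^ 40) ^ 2 := by ring
    have h2 : (Real.log M + C₀) / Real.log ((2 ^ j₁ : ℕ) : ℝ) ≤ 88 + 2 * C₀ := by
      rw [div_le_iff₀ (by linarith)]
      nlinarith
    have h3 : 2 / Real.log M ≤ 240 / l ^ 12 := by
      rw [← hlog]
      calc 2 / Real.log M ≤ 2 / Real.log u := by gcongr
        _ = 240 / (120 * Real.log u) := by
          have : Real.log u ≠ 0 := by linarith
          field_simp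
          norm_num
    calc Real.sqrt M + 2 / Real.log M * (C₀ * M * (((2 ^ (n + 1) : ℕ) : ℝ) *
          Real.exp (2 * ((Real.log M + C₀) / Real.log ((2 ^ j₁ : ℕ) : ℝ)))))
        ≤ u ^ 40 / l ^ 2 + 240 / l ^ 12 * (C₀ * (u ^ 40 * l ^ 4) * ((2 * l ^ 6) *
          Real.exp (2 * (88 + 2 * C₀)))) := by
          push_cast at h2 ⊢
          gcongr
      _ = (1 + 480 * (C₀ * Real.exp (2 * (88 + 2 * C₀)))) * (u ^ 40 / l ^ 2) := by
          field_simp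
          ring
  have hsqrt : Real.sqrt (M * ((2 ^ j₁) ^ 2 * (2 * (D / B + 1) ^ 2))) ≤ u ^ 34 * l ^ 3 := by
    rw [Real.sqrt_le_iff]
    refine ⟨by positivity, ?_⟩
    have h1 : (D : ℝ) / B + 1 ≤ 3 * (u ^ 12 * l) := by
      have h2 : (D : ℝ) / B ≤ 2 * (u ^ 12 * l) := by
        rw [div_le_iff₀ hBpos]
        calc (D : ℝ) ≤ u ^ 40 * l := hDle
          _ = 2 * (u ^ 12 * l) * (u ^ 28 / 2) := by ring
          _ ≤ 2 * (u ^ 12 * l) * B := by gcongr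
      have h3 : 1 ≤ u ^ 12 * l := one_le_mul_of_one_le_of_one_le (one_le_pow₀ hu1) hl
      linarith
    calc (M : ℝ) * ((2 ^ j₁) ^ 2 * (2 * (D / B + 1) ^ 2))
        ≤ (u ^ 40 * l ^ 4) * (u ^ 2 * (2 * (3 * (u ^ 12 * l)) ^ 2)) := by gcongr
      _ = 18 * (u ^ 66 * l ^ 6) := by ring
      _ ≤ u ^ 2 * (u ^ 66 * l ^ 6) := by
        gcongr
        nlinarith
      _ = (u ^ 34 * l ^ 3) ^ 2 := by ring
  have hsum : ∑ j ∈ Finset.Ico (n + 1) j₁, ((dyadicSolutions q D M j α).card : ℝ)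
      ≤ 5 * (u ^ 40 / l ^ 2) := by
    calc ∑ j ∈ Finset.Ico (n + 1) j₁, ((dyadicSolutions q D M j α).card : ℝ)
        ≤ ∑ j ∈ Finset.Ico (n + 1) j₁, (2 * M * (1 / 2 ^ j) + u ^ 34 * l ^ 3) := by
          refine Finset.sum_le_sum fun j hj => ?_
          refine (card_dyadicSolutions_le hα (Finset.mem_Ico.1 hj).2 hB (by exact_mod_cast hBpos)
            hzq hDq hMq).trans (add_le_add (le_of_eq (by ring)) hsqrt)
      _ = 2 * M * ∑ j ∈ Finset.Ico (n + 1) j₁, (1 : ℝ) / 2 ^ j + ((j₁ - (n + 1) : ℕ) : ℝ) * (u ^ 34 * l ^ 3) := by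
          rw [Finset.sum_add_distrib, ← Finset.mul_sum, Finset.sum_const, Nat.card_Ico, nsmul_eq_mul]
      _ ≤ 2 * (u ^ 40 * l ^ 4) * (2 / l ^ 6) + u * (u ^ 34 * l ^ 3) := by
          have h1 : ∑ j ∈ Finset.Ico (n + 1) j₁, (1 : ℝ) / 2 ^ j ≤ 2 / l ^ 6 :=
            (sum_Ico_inv_two_pow_le _ _).trans (by gcongr)
          -- The number of dyadic intervals is at most j₁ ≤ 2^j₁ ≤ u, crude but absorbed by the
          -- power saving.
          have h2 : ((j₁ - (n + 1) : ℕ) : ℝ) ≤ u := by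
            refine le_trans ?_ hj1
            exact_mod_cast (Nat.sub_le _ _).trans Nat.lt_two_pow_self.le
          gcongr
      _ ≤ 4 * (u ^ 40 / l ^ 2) + u ^ 40 / l ^ 2 := by
          refine add_le_add (le_of_eq ?_) ?_
          · field_simp
            ring
          · rw [le_div_iff₀ (by positivity)]
            calc u * (u ^ 34 * l ^ 3) * l ^ 2 = u ^ 35 * l ^ 5 := by ring
              _ ≤ u ^ 35 * u ^ 5 := by gcongr
              _ = u ^ 40 := by ring
      _ = 5 * (u ^ 40 / l ^ 2) := by ring
  calc ((squareMulSolutions q D M α).card : ℝ)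
      ≤ 2 * (((Finset.Ioc 0 M).filter (FreeOfPrimes (2 ^ (n + 1)) (2 ^ j₁))).card : ℝ)
        + ∑ j ∈ Finset.Ico (n + 1) j₁, ((dyadicSolutions q D M j α).card : ℝ) := by
          exact_mod_cast hcount
    _ ≤ 2 * ((1 + 480 * (C₀ * Real.exp (2 * (88 + 2 * C₀)))) * (u ^ 40 / l ^ 2))
        + 5 * (u ^ 40 / l ^ 2) := by
          gcongr
    _ = _ := by ring

/-! ### Reduction of the error term to large square divisors -/

/-- Write n = b²a with a squarefree. Then d² ∣ n exactly when d ∣ b, and the sum of μ over the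
divisors of b detects b = 1. -/
theorem moebiusSq_eq_sum {n N : ℕ} (hn : 1 ≤ n) (hN : n ≤ N) :
    moebiusSq n = ∑ d ∈ (Finset.Icc 1 N).filter (fun d => d ^ 2 ∣ n), ((μ d : ℤ) : ℝ) := by
  obtain ⟨a, b, hab, ha⟩ := Nat.sq_mul_squarefree n
  have hb : b ≠ 0 := by rintro rfl; simp at hab; omega
  have hset : (Finset.Icc 1 N).filter (fun d => d ^ 2 ∣ n) = b.divisors := by
    ext d
    rw [Finset.mem_filter, Finset.mem_Icc, Nat.mem_divisors]
    constructor
    · rintro ⟨-, hd⟩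
      refine ⟨?_, hb⟩
      rw [← hab] at hd
      have ha0 : a ≠ 0 := ha.ne_zero
      have hd0 : d ≠ 0 := by
        rintro rfl
        simp [ha0, hb] at hd
      rw [← Nat.factorization_le_iff_dvd (by positivity) (by positivity)] at hd
      rw [← Nat.factorization_le_iff_dvd hd0 hb]
      intro p
      have h1 := hd p
      have h2 := ha.natFactorization_le_one p
      rw [Nat.factorization_mul (by positivity) ha0, Nat.factorization_pow, Nat.factorization_pow] at h1
      simp only [Finsupp.coe_smul, Finsupp.coe_add, Pi.add_apply, Pi.smul_apply, smul_eq_mul] at h1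
      omega
    · rintro ⟨hd, -⟩
      have h1 : d ^ 2 ∣ n := by
        rw [← hab]
        exact (pow_dvd_pow_of_dvd hd 2).mul_right _
      have hd0 : d ≠ 0 := by rintro rfl; simp at hd; exact hb hd
      have h2 := Nat.le_of_dvd (by omega) h1
      have h3 : d ≤ d ^ 2 := Nat.le_self_pow (by norm_num) d
      exact ⟨⟨by omega, by omega⟩, h1⟩
  rw [hset, moebiusSq]
  have h1 := congrArg (fun f => f b) ArithmeticFunction.coe_zeta_mul_moebius
  rw [ArithmeticFunction.coe_zeta_mul_apply, ArithmeticFunction.one_apply] at h1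
  rw [← Int.cast_sum, h1, ← Int.cast_pow, ArithmeticFunction.moebius_sq]
  congr 1
  by_cases h : b = 1
  · subst h
    simp at hab
    rw [if_pos (hab ▸ ha), if_pos rfl]
  · rw [if_neg h, if_neg]
    intro hs
    refine h (Nat.isUnit_iff.1 (hs b ⟨a, ?_⟩))
    rw [← hab]; ring

/-- The multiples `d² m ≤ N` of `d²` in the residue class `α`, counted by `m`. -/
def sqMultiples (q N d : ℕ) (α : ZMod q) : Finset ℕ :=
  (Finset.Icc 1 (N / d ^ 2)).filter (fun m : ℕ => (m : ZMod q) * (d : ZMod q) ^ 2 = α)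

theorem progressionSum_moebiusSq (X : ℝ) (q : ℕ) (a : ℤ) :
    progressionSum moebiusSq X q a =
      ∑ d ∈ Finset.Icc 1 ⌊X⌋₊, ((μ d : ℤ) : ℝ) * (sqMultiples q ⌊X⌋₊ d (a : ZMod q)).card := by
  set N := ⌊X⌋₊
  set I := (Finset.Icc 1 N).filter (fun n : ℕ => (n : ℤ) ≡ a [ZMOD (q : ℤ)]) with hI
  have h1 : progressionSum moebiusSq X q a =
      ∑ n ∈ I, ∑ d ∈ Finset.Icc 1 N, if d ^ 2 ∣ n then ((μ d : ℤ) : ℝ) else 0 := by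
    refine Finset.sum_congr rfl fun n hn => ?_
    have hn' := Finset.mem_Icc.1 (Finset.mem_filter.1 hn).1
    rw [moebiusSq_eq_sum hn'.1 hn'.2, Finset.sum_filter]
  rw [h1, Finset.sum_comm]
  refine Finset.sum_congr rfl fun d hd => ?_
  have hd0 : 0 < d := (Finset.mem_Icc.1 hd).1
  rw [← Finset.sum_filter, Finset.sum_const, nsmul_eq_mul, mul_comm]
  congr 2
  refine (Finset.card_bij (fun m _ => m * d ^ 2) ?_ ?_ ?_).symm
  · intro m hm
    simp only [sqMultiples, Finset.mem_filter, Finset.mem_Icc] at hm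
    simp only [hI, Finset.mem_filter, Finset.mem_Icc]
    refine ⟨⟨⟨Nat.mul_pos hm.1.1 (by positivity), ?_⟩, ?_⟩, Dvd.intro_left _ rfl⟩
    · exact (Nat.le_div_iff_mul_le (by positivity)).1 hm.1.2
    · rw [← ZMod.intCast_eq_intCast_iff]
      push_cast
      exact hm.2
  · intro m _ m' _ h
    exact Nat.eq_of_mul_eq_mul_right (by positivity) h
  · intro n hn
    simp only [hI, Finset.mem_filter, Finset.mem_Icc] at hn
    obtain ⟨⟨⟨hn1, hn2⟩, hn3⟩, m, rfl⟩ := hn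
    refine ⟨m, ?_, mul_comm _ _⟩
    simp only [sqMultiples, Finset.mem_filter, Finset.mem_Icc]
    refine ⟨⟨Nat.pos_of_mul_pos_left hn1, ?_⟩, ?_⟩
    · rw [Nat.le_div_iff_mul_le (by positivity), mul_comm]; exact hn2
    · rw [← ZMod.intCast_eq_intCast_iff] at hn3
      push_cast at hn3
      rw [← hn3]; ring

theorem card_residue_class_bounds (q : ℕ) [NeZero q] (Y : ℕ) (β : ZMod q) :
    Y / q ≤ ((Finset.Icc 1 Y).filter (fun m : ℕ => (m : ZMod q) = β)).card ∧
      ((Finset.Icc 1 Y).filter (fun m : ℕ => (m : ZMod q) = β)).card ≤ Y / q + 1 := by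
  have hq : 0 < q := Nat.pos_of_ne_zero (NeZero.ne q)
  have h1 := Nat.Ioc_filter_modEq_card 0 Y hq β.val
  have h2 : (Finset.Icc 1 Y).filter (fun m : ℕ => (m : ZMod q) = β) =
      (Finset.Ioc 0 Y).filter (fun m : ℕ => m ≡ β.val [MOD q]) := by
    ext m
    rw [Finset.mem_filter, Finset.mem_filter, ← ZMod.natCast_eq_natCast_iff, ZMod.natCast_zmod_val,
      Finset.mem_Icc, Finset.mem_Ioc, Nat.succ_le_iff]
  have h3 : ⌊((Y : ℕ) : ℚ) / q⌋ = ((Y / q : ℕ) : ℤ) := by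
    rw [← Nat.floor_div_eq_div (K := ℚ), Int.natCast_floor_eq_floor (by positivity)]
  have h4 := Int.le_floor_add ((Y : ℚ) / q) ((((0 : ℕ) : ℚ) - β.val) / q)
  have h5 := Int.le_floor_add_floor ((Y : ℚ) / q) ((((0 : ℕ) : ℚ) - β.val) / q)
  have h6 : (Y : ℚ) / q + (((0 : ℕ) : ℚ) - β.val) / q = ((Y : ℚ) - β.val) / q := by
    rw [← add_div]; push_cast; ring
  rw [h6, h3] at h4 h5
  rw [h2]
  generalize (Y / q) = k at *
  omega

/-- If q ∣ d, neither nonzero class is met. Otherwise m runs over one residue class up to N/d², and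
any such class has ⌊N/d²/q⌋ or one more elements. -/
theorem abs_card_sqMultiples_sub_le (q : ℕ) [Fact q.Prime] (N d : ℕ) {α β : ZMod q} (hα : α ≠ 0)
    (hβ : β ≠ 0) :
    |((sqMultiples q N d α).card : ℝ) - (sqMultiples q N d β).card| ≤ 1 := by
  by_cases hd : (d : ZMod q) = 0
  · have h0 : ∀ γ : ZMod q, γ ≠ 0 → (sqMultiples q N d γ).card = 0 := by
      intro γ hγ
      rw [Finset.card_eq_zero, sqMultiples, Finset.filter_eq_empty_iff]
      intro m _ h
      rw [hd] at h
      simp at h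
      exact hγ h.symm
    rw [h0 α hα, h0 β hβ]; simp
  · have h1 : ∀ γ : ZMod q, sqMultiples q N d γ =
        (Finset.Icc 1 (N / d ^ 2)).filter (fun m : ℕ => (m : ZMod q) = γ / (d : ZMod q) ^ 2) := by
      intro γ
      refine Finset.filter_congr fun m _ => ?_
      rw [eq_div_iff (pow_ne_zero 2 hd)]
    have h2 := card_residue_class_bounds q (N / d ^ 2) (α / (d : ZMod q) ^ 2)
    have h3 := card_residue_class_bounds q (N / d ^ 2) (β / (d : ZMod q) ^ 2)
    rw [← h1] at h2 h3
    have e1 : ((sqMultiples q N d α).card : ℝ) ≤ (sqMultiples q N d β).card + 1 := by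
      exact_mod_cast (by omega)
    have e2 : ((sqMultiples q N d β).card : ℝ) ≤ (sqMultiples q N d α).card + 1 := by
      exact_mod_cast (by omega)
    rw [abs_le]; constructor <;> linarith

/-- The number of multiples `d² m ≤ N` in the residue class `α` with `d > D`. -/
def largeSquareCount (q N D : ℕ) (α : ZMod q) : ℕ :=
  ∑ d ∈ Finset.Ioc D N, (sqMultiples q N d α).card

theorem abs_progressionSum_sub_le (X : ℝ) (q : ℕ) [Fact q.Prime] (D : ℕ) {a b : ℤ}
    (ha : (a : ZMod q) ≠ 0) (hb : (b : ZMod q) ≠ 0) :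
    |progressionSum moebiusSq X q a - progressionSum moebiusSq X q b| ≤
      D + largeSquareCount q ⌊X⌋₊ D a + largeSquareCount q ⌊X⌋₊ D b := by
  rw [progressionSum_moebiusSq, progressionSum_moebiusSq, ← Finset.sum_sub_distrib]
  set N := ⌊X⌋₊
  have hμ : ∀ d, |((μ d : ℤ) : ℝ)| ≤ 1 := by
    intro d
    exact_mod_cast ArithmeticFunction.abs_moebius_le_one (n := d)
  have hsplit : ∀ d, 1 ≤ d → |((μ d : ℤ) : ℝ) * ((sqMultiples q N d (a : ZMod q)).card : ℝ)
      - ((μ d : ℤ) : ℝ) * ((sqMultiples q N d (b : ZMod q)).card : ℝ)| ≤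
      (if d ≤ D then 1 else 0) + (if D < d then ((sqMultiples q N d (a : ZMod q)).card : ℝ)
        + (sqMultiples q N d (b : ZMod q)).card else 0) := by
    intro d hd
    rw [← mul_sub, abs_mul]
    refine (mul_le_of_le_one_left (abs_nonneg _) (hμ d)).trans ?_
    by_cases h : d ≤ D
    · rw [if_pos h, if_neg (by omega), add_zero]
      exact abs_card_sqMultiples_sub_le q N d ha hb
    · rw [if_neg h, if_pos (by omega), zero_add]
      rw [abs_le]
      have h1 : (0 : ℝ) ≤ (sqMultiples q N d (a : ZMod q)).card := by positivity
      have h2 : (0 : ℝ) ≤ (sqMultiples q N d (b : ZMod q)).card := by positivity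
      constructor <;> linarith
  refine (Finset.abs_sum_le_sum_abs _ _).trans
    ((Finset.sum_le_sum fun d hd => hsplit d (Finset.mem_Icc.1 hd).1).trans ?_)
  rw [Finset.sum_add_distrib, add_assoc]
  refine add_le_add ?_ (le_of_eq ?_)
  · rw [← Finset.sum_filter, Finset.sum_const, nsmul_eq_mul, mul_one]
    have : ((Finset.Icc 1 N).filter (fun d => d ≤ D)).card ≤ D := by
      refine (Finset.card_le_card (t := Finset.Icc 1 D) fun d hd => ?_).trans (by simp)
      simp only [Finset.mem_filter, Finset.mem_Icc] at hd ⊢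
      omega
    exact_mod_cast this
  · rw [← Finset.sum_filter, Finset.sum_add_distrib, largeSquareCount, largeSquareCount,
      Nat.cast_sum, Nat.cast_sum]
    have : (Finset.Icc 1 N).filter (fun d => D < d) = Finset.Ioc D N := by
      ext d
      simp only [Finset.mem_filter, Finset.mem_Icc, Finset.mem_Ioc]
      omega
    rw [this]

theorem coprimeAverage_eq (f : ℕ → ℝ) (X : ℝ) (q : ℕ) (hq : q.Prime) :
    coprimeAverage f X q = 1 / (q.totient : ℝ) * ∑ b ∈ Finset.Ico 1 q, progressionSum f X q (b : ℤ) := by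
  rw [coprimeAverage]
  congr 1
  rw [← Finset.sum_fiberwise_of_maps_to (g := fun n => n % q) (t := Finset.Ico 1 q)]
  · refine Finset.sum_congr rfl fun b hb => ?_
    rw [Finset.mem_Ico] at hb
    rw [progressionSum, Finset.filter_filter]
    refine Finset.sum_congr (Finset.filter_congr fun n _ => ?_) fun _ _ => rfl
    rw [Int.natCast_modEq_iff, Nat.ModEq, Nat.mod_eq_of_lt hb.2, and_iff_right_iff_imp]
    intro h
    rw [Nat.coprime_comm, hq.coprime_iff_not_dvd, Nat.dvd_iff_mod_eq_zero]
    omega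
  · intro n hn
    have h := (Finset.mem_filter.1 hn).2
    rw [Nat.coprime_comm, hq.coprime_iff_not_dvd, Nat.dvd_iff_mod_eq_zero] at h
    rw [Finset.mem_Ico]
    exact ⟨by omega, Nat.mod_lt _ hq.pos⟩

/-- Since q is prime, the subtracted average is the mean over b = 1, …, q − 1, so a bound for each
difference of two classes bounds the error. -/
theorem abs_progressionError_le (X : ℝ) (q : ℕ) [Fact q.Prime] (D : ℕ) (K : ℝ)
    (hK : ∀ α : ZMod q, α ≠ 0 → (largeSquareCount q ⌊X⌋₊ D α : ℝ) ≤ K) {a : ℤ}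
    (ha : (a : ZMod q) ≠ 0) :
    |progressionError moebiusSq X q a| ≤ D + 2 * K := by
  have hq : q.Prime := Fact.out
  have hφ : (0 : ℝ) < q.totient := by exact_mod_cast Nat.totient_pos.2 hq.pos
  have hcard : ((Finset.Ico 1 q).card : ℝ) = q.totient := by
    rw [Nat.card_Ico, Nat.totient_prime hq]
  have h1 : progressionError moebiusSq X q a = 1 / (q.totient : ℝ) *
      ∑ b ∈ Finset.Ico 1 q, (progressionSum moebiusSq X q a - progressionSum moebiusSq X q (b : ℤ)) := by
    rw [progressionError, coprimeAverage_eq _ _ _ hq, Finset.sum_sub_distrib, Finset.sum_const,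
      nsmul_eq_mul, hcard]
    field_simp
  rw [h1, abs_mul, abs_of_pos (by positivity), one_div_mul_eq_div, div_le_iff₀ hφ]
  refine (Finset.abs_sum_le_sum_abs _ _).trans ?_
  calc ∑ b ∈ Finset.Ico 1 q, |progressionSum moebiusSq X q a - progressionSum moebiusSq X q (b : ℤ)|
      ≤ ∑ b ∈ Finset.Ico 1 q, (D + 2 * K) := by
        refine Finset.sum_le_sum fun b hb => ?_
        rw [Finset.mem_Ico] at hb
        have hb0 : (((b : ℤ)) : ZMod q) ≠ 0 := by
          rw [Int.cast_natCast, Ne, ZMod.natCast_eq_zero_iff]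
          exact fun h => absurd (Nat.le_of_dvd hb.1 h) (by omega)
        refine (abs_progressionSum_sub_le X q D ha hb0).trans ?_
        linarith [hK _ ha, hK _ hb0]
    _ = (D + 2 * K) * q.totient := by
        rw [Finset.sum_const, nsmul_eq_mul, hcard]; ring

theorem sum_inv_sqrt_le (n : ℕ) : ∑ m ∈ Finset.Icc 1 n, 1 / Real.sqrt m ≤ 2 * Real.sqrt n := by
  induction n with
  | zero => simp
  | succ n ih =>
    rw [Finset.sum_Icc_succ_top (by omega)]
    have h1 : 0 < Real.sqrt ((n + 1 : ℕ) : ℝ) := Real.sqrt_pos.2 (by positivity)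
    have h2 := Real.sq_sqrt (by positivity : (0 : ℝ) ≤ ((n + 1 : ℕ) : ℝ))
    have h3 := Real.sq_sqrt (by positivity : (0 : ℝ) ≤ (n : ℝ))
    have h4 := Real.sqrt_nonneg (n : ℝ)
    have h5 : 1 / Real.sqrt ((n + 1 : ℕ) : ℝ) ≤ 2 * Real.sqrt ((n + 1 : ℕ) : ℝ) - 2 * Real.sqrt n := by
      rw [div_le_iff₀ h1]
      push_cast at h2 h1 ⊢
      nlinarith [sq_nonneg (Real.sqrt ((n : ℝ) + 1) - Real.sqrt n)]
    linarith

/-- Pairs with m ≤ M are counted by m: d is at most √(N/m) and lies in at most two classes modulo q,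
and ∑ 1/√m ≤ 2√M. Pairs with m > M are left to the box count. -/
theorem largeSquareCount_le {q N D M D₁ M₁ : ℕ} [Fact q.Prime] {α : ZMod q} (hα : α ≠ 0)
    (h : ∀ d m : ℕ, D < d → M < m → m * d ^ 2 ≤ N → d ≤ D₁ ∧ m ≤ M₁) :
    (largeSquareCount q N D α : ℝ) ≤ 2 * M + 4 * Real.sqrt N * Real.sqrt M / q
      + (squareMulSolutions q D₁ M₁ α).card := by
  have hq0 : (0 : ℝ) < q := by exact_mod_cast (Fact.out : q.Prime).pos
  let T : Finset (Σ _ : ℕ, ℕ) := (Finset.Ioc D N).sigma fun d => sqMultiples q N d α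
  have hT : largeSquareCount q N D α = T.card := (Finset.card_sigma _ _).symm
  have hmem : ∀ t ∈ T, D < t.1 ∧ 1 ≤ t.2 ∧ t.2 * t.1 ^ 2 ≤ N ∧ (t.2 : ZMod q) * (t.1 : ZMod q) ^ 2 = α := by
    intro t ht
    simp only [T, sqMultiples, Finset.mem_sigma, Finset.mem_Ioc, Finset.mem_filter, Finset.mem_Icc] at ht
    refine ⟨ht.1.1, ht.2.1.1, ?_, ht.2.2⟩
    have : 0 < t.1 := by omega
    exact (Nat.le_div_iff_mul_le (by positivity)).1 ht.2.1.2
  have hm0 : ∀ t ∈ T, (t.2 : ZMod q) ≠ 0 := by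
    intro t ht h0
    have := (hmem t ht).2.2.2
    rw [h0, zero_mul] at this
    exact hα this.symm
  have h1 : ((T.filter (fun t => t.2 ≤ M)).card : ℝ) ≤ 2 * M + 4 * Real.sqrt N * Real.sqrt M / q := by
    have h2 : (T.filter (fun t => t.2 ≤ M)).card ≤
        ∑ m ∈ Finset.Icc 1 M, 2 * (Nat.sqrt (N / m) / q + 1) := by
      rw [Finset.card_eq_sum_card_fiberwise (f := fun t => t.2) (t := Finset.Icc 1 M)]
      · refine Finset.sum_le_sum fun m hm => ?_
        refine le_trans (Finset.card_le_card_of_injOn (fun t => t.1) ?_ ?_)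
          (card_sq_eq_le q (α / m) (Nat.sqrt (N / m)))
        · intro t ht
          simp only [Finset.coe_filter, Finset.mem_filter, Set.mem_ofPred_eq] at ht
          obtain ⟨⟨ht1, ht2⟩, rfl⟩ := ht
          have ht3 := hmem t ht1
          simp only [Finset.coe_filter, Finset.mem_Icc, Set.mem_ofPred_eq]
          refine ⟨⟨by omega, ?_⟩, ?_⟩
          · rw [Nat.le_sqrt', Nat.le_div_iff_mul_le ht3.2.1, mul_comm]
            exact ht3.2.2.1
          · rw [eq_div_iff (hm0 t ht1), mul_comm]
            exact ht3.2.2.2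
        · intro t ht u hu htu
          simp only [Finset.coe_filter, Set.mem_ofPred_eq] at ht hu
          obtain ⟨t1, t2⟩ := t
          obtain ⟨u1, u2⟩ := u
          simp only at htu ht hu
          rw [htu, ht.2, hu.2]
      · intro t ht
        simp only [Finset.coe_filter, Set.mem_ofPred_eq] at ht
        simp only [Finset.coe_Icc, Set.mem_Icc]
        exact ⟨(hmem t ht.1).2.1, ht.2⟩
    calc ((T.filter (fun t => t.2 ≤ M)).card : ℝ)
        ≤ ∑ m ∈ Finset.Icc 1 M, 2 * (((Nat.sqrt (N / m) / q : ℕ) : ℝ) + 1) := by exact_mod_cast h2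
      _ ≤ ∑ m ∈ Finset.Icc 1 M, (2 * Real.sqrt N / q * (1 / Real.sqrt m) + 2) := by
          refine Finset.sum_le_sum fun m _ => ?_
          have h3 : ((Nat.sqrt (N / m) / q : ℕ) : ℝ) ≤ Real.sqrt N / Real.sqrt m / q := by
            refine Nat.cast_div_le.trans ?_
            gcongr
            refine Real.nat_sqrt_le_real_sqrt.trans ?_
            rw [← Real.sqrt_div (by positivity)]
            exact Real.sqrt_le_sqrt Nat.cast_div_le
          calc 2 * (((Nat.sqrt (N / m) / q : ℕ) : ℝ) + 1) ≤ 2 * (Real.sqrt N / Real.sqrt m / q + 1) := by gcongr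
            _ = _ := by ring
      _ = 2 * Real.sqrt N / q * ∑ m ∈ Finset.Icc 1 M, (1 / Real.sqrt m) + 2 * M := by
          rw [Finset.sum_add_distrib, ← Finset.mul_sum, Finset.sum_const, Nat.card_Icc,
            Nat.add_sub_cancel, nsmul_eq_mul]
          ring
      _ ≤ 2 * Real.sqrt N / q * (2 * Real.sqrt M) + 2 * M := by
          gcongr
          exact sum_inv_sqrt_le M
      _ = _ := by ring
  have h2 : (T.filter (fun t => ¬ t.2 ≤ M)).card ≤ (squareMulSolutions q D₁ M₁ α).card := by
    refine Finset.card_le_card_of_injOn (fun t => (t.1, t.2)) ?_ ?_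
    · intro t ht
      simp only [Finset.coe_filter, Set.mem_ofPred_eq] at ht
      have ht3 := hmem t ht.1
      have ht4 := h t.1 t.2 ht3.1 (by omega) ht3.2.2.1
      rw [Finset.mem_coe, mem_squareMulSolutions]
      exact ⟨⟨⟨Nat.one_le_of_lt ht3.1, ht4.1⟩, ⟨ht3.2.1, ht4.2⟩⟩, ht3.2.2.2⟩
    · rintro ⟨t1, t2⟩ _ ⟨u1, u2⟩ _ htu
      simp only [Prod.mk.injEq] at htu
      rw [htu.1, htu.2]
  rw [hT, ← Finset.card_filter_add_card_filter_not (fun t : Σ _ : ℕ, ℕ => t.2 ≤ M)]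
  push_cast
  have : ((T.filter (fun t => ¬ t.2 ≤ M)).card : ℝ) ≤ (squareMulSolutions q D₁ M₁ α).card := by
    exact_mod_cast h2
  linarith

/-! ### The bound for the error term -/

theorem eventually_four_mul_sqrt_log_le :
    ∀ᶠ X : ℝ in Filter.atTop, 4 * Real.log X ^ (1 / 2 : ℝ) ≤ X ^ (1 / 120 : ℝ) := by
  have h := (isLittleO_log_rpow_atTop (r := 1 / 60) (by norm_num)).bound (by norm_num : (0 : ℝ) < 1 / 16)
  filter_upwards [h, Filter.eventually_ge_atTop 1] with X hX hX1
  have hlog := Real.log_nonneg hX1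
  rw [Real.norm_of_nonneg hlog, Real.norm_of_nonneg (by positivity)] at hX
  have h1 : Real.log X ^ (1 / 2 : ℝ) ≤ (1 / 16 * X ^ (1 / 60 : ℝ)) ^ (1 / 2 : ℝ) :=
    Real.rpow_le_rpow hlog hX (by norm_num)
  rw [Real.mul_rpow (by norm_num) (by positivity), ← Real.rpow_mul (by linarith)] at h1
  have h2 : (1 / 16 : ℝ) ^ (1 / 2 : ℝ) = 1 / 4 := by
    rw [← Real.sqrt_eq_rpow, show (1 / 16 : ℝ) = (1 / 4) ^ 2 by norm_num, Real.sqrt_sq (by norm_num)]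
  rw [h2] at h1
  norm_num at h1 ⊢
  linarith

/-- `largeSquareCount_le` is used with M = D. The two sizes of q call for different D: below X^(1/2)
a cutoff at X^(1/3) already suffices, above it the box count is needed. -/
theorem exists_abs_progressionError_le_of_large :
    ∃ C X₁ : ℝ, 0 ≤ C ∧ 3 ≤ X₁ ∧ ∀ X : ℝ, X₁ ≤ X → ∀ q : ℕ, q.Prime → ∀ a : ℤ, IsCoprime a (q : ℤ) →
      |progressionError moebiusSq X q a| ≤
        C * (X ^ (1 / 3 : ℝ) / Real.log X ^ (1 / 6 : ℝ) + X ^ (5 / 6 : ℝ) / q) := by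
  obtain ⟨C, hC⟩ := exists_card_squareMulSolutions_le
  obtain ⟨X₂, hX₂⟩ := Filter.eventually_atTop.1 eventually_four_mul_sqrt_log_le
  refine ⟨13 + 2 * |C|, max X₂ (18 ^ 120), by positivity, le_max_of_le_right (by norm_num), ?_⟩
  intro X hX q hq a ha
  have hX4 := hX₂ X ((le_max_left _ _).trans hX)
  have hX18 : (18 : ℝ) ^ 120 ≤ X := (le_max_right _ _).trans hX
  have hX0 : 0 < X := lt_of_lt_of_le (by positivity) hX18
  have := Fact.mk hq
  have ha0 : (a : ZMod q) ≠ 0 := by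
    intro h
    rw [ZMod.intCast_zmod_eq_zero_iff_dvd] at h
    have h1 := ha.isUnit_of_dvd' h dvd_rfl
    rw [Int.isUnit_iff_natAbs_eq, Int.natAbs_natCast] at h1
    exact hq.one_lt.ne' h1
  set u := X ^ (1 / 120 : ℝ) with hu
  set l := Real.log X ^ (1 / 12 : ℝ) with hl
  have hu0 : 0 < u := by positivity
  have hXu : X = u ^ 120 := by
    rw [hu, ← Real.rpow_natCast, ← Real.rpow_mul hX0.le]; norm_num
  have hu18 : 18 ≤ u := by
    rw [hXu] at hX18
    exact le_of_pow_le_pow_left₀ (by norm_num) hu0.le hX18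
  have hu1 : 1 ≤ u := by linarith
  have hlogX : 1 ≤ Real.log X := by
    rw [Real.le_log_iff_exp_le hX0]
    have : u ≤ X := by rw [hXu]; exact le_self_pow₀ hu1 (by norm_num)
    linarith [Real.exp_one_lt_d9]
  have hl1 : 1 ≤ l := Real.one_le_rpow hlogX (by norm_num)
  have hl12 : l ^ 12 = Real.log X := by
    rw [hl, ← Real.rpow_natCast, ← Real.rpow_mul (by linarith)]; norm_num
  have hl6 : l ^ 6 = Real.log X ^ (1 / 2 : ℝ) := by
    rw [hl, ← Real.rpow_natCast, ← Real.rpow_mul (by linarith)]; norm_num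
  have hl2 : Real.log X ^ (1 / 6 : ℝ) = l ^ 2 := by
    rw [hl, ← Real.rpow_natCast, ← Real.rpow_mul (by linarith)]; norm_num
  have hX3 : X ^ (1 / 3 : ℝ) = u ^ 40 := by
    rw [hu, ← Real.rpow_natCast, ← Real.rpow_mul hX0.le]; norm_num
  have hX56 : X ^ (5 / 6 : ℝ) = u ^ 100 := by
    rw [hu, ← Real.rpow_natCast, ← Real.rpow_mul hX0.le]; norm_num
  have hlog : 120 * Real.log u = l ^ 12 := by
    rw [hl12, hXu, Real.log_pow]; norm_num
  rw [hX3, hl2, hX56]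
  rw [← hl6] at hX4
  have hl0 : 0 < l := by linarith
  have hq0 : (0 : ℝ) < q := by exact_mod_cast hq.pos
  set N := ⌊X⌋₊ with hN
  have hNX : (N : ℝ) ≤ u ^ 120 := by rw [← hXu]; exact Nat.floor_le hX0.le
  have hsqrtN : Real.sqrt N ≤ u ^ 60 := by
    rw [Real.sqrt_le_iff]
    refine ⟨by positivity, hNX.trans (le_of_eq (by ring))⟩
  have hsqrt : ∀ M : ℕ, (M : ℝ) ≤ u ^ 40 → 4 * Real.sqrt N * Real.sqrt M / q ≤ 4 * (u ^ 100 / q) := by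
    intro M hM
    have h1 : Real.sqrt M ≤ u ^ 20 := by
      rw [Real.sqrt_le_iff]
      refine ⟨by positivity, hM.trans (le_of_eq (by ring))⟩
    calc 4 * Real.sqrt N * Real.sqrt M / q ≤ 4 * u ^ 60 * u ^ 20 / q := by gcongr
      _ = 4 * (u ^ 80 / q) := by ring
      _ ≤ 4 * (u ^ 100 / q) := by gcongr; norm_num
  have hA : 0 ≤ u ^ 40 / l ^ 2 := by positivity
  have hB : 0 ≤ u ^ 100 / (q : ℝ) := by positivity
  rcases lt_or_ge (q : ℝ) (u ^ 60) with hqu | hqu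
  · set D := ⌊u ^ 40⌋₊ with hD
    have hDle : (D : ℝ) ≤ u ^ 40 := Nat.floor_le (by positivity)
    have hDlt : u ^ 40 < (D : ℝ) + 1 := Nat.lt_floor_add_one _
    -- Both d and m above X^(1/3) would force m d² > X, so the box is empty.
    have key : ∀ d m : ℕ, D < d → D < m → m * d ^ 2 ≤ N → d ≤ 0 ∧ m ≤ 0 := by
      intro d m hd hm hdm
      exfalso
      have hd' : u ^ 40 < (d : ℝ) := hDlt.trans_le (by exact_mod_cast hd)
      have hm' : u ^ 40 < (m : ℝ) := hDlt.trans_le (by exact_mod_cast hm)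
      have h1 : (m : ℝ) * d ^ 2 ≤ u ^ 120 := le_trans (by exact_mod_cast hdm) hNX
      have h2 : u ^ 40 * (u ^ 40) ^ 2 < (m : ℝ) * d ^ 2 := by gcongr
      have h3 : u ^ 40 * (u ^ 40) ^ 2 = u ^ 120 := by ring
      linarith
    have h40 : u ^ 40 ≤ u ^ 100 / q := by
      rw [le_div_iff₀ hq0]
      calc u ^ 40 * q ≤ u ^ 40 * u ^ 60 := by gcongr
        _ = u ^ 100 := by ring
    have hK : ∀ α : ZMod q, α ≠ 0 → (largeSquareCount q N D α : ℝ) ≤ 6 * (u ^ 100 / q) := by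
      intro α hα
      have h1 := largeSquareCount_le hα key
      have h2 : squareMulSolutions q 0 0 α = ∅ := by simp [squareMulSolutions]
      rw [h2, Finset.card_empty, Nat.cast_zero] at h1
      linarith [hsqrt D hDle]
    have h1 := abs_progressionError_le X q D _ hK ha0
    nlinarith [abs_nonneg C]
  · set D := ⌊u ^ 40 / l ^ 2⌋₊ with hD
    have hDle : (D : ℝ) ≤ u ^ 40 / l ^ 2 := Nat.floor_le (by positivity)
    have hDlt : u ^ 40 / l ^ 2 < (D : ℝ) + 1 := Nat.lt_floor_add_one _
    -- From m d² ≤ u^120, a lower bound u^40/l² for one variable caps the other: d ≤ u^40 l and m ≤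
    -- u^40 l⁴.
    have key : ∀ d m : ℕ, D < d → D < m → m * d ^ 2 ≤ N →
        d ≤ ⌊u ^ 40 * l⌋₊ ∧ m ≤ ⌊u ^ 40 * l ^ 4⌋₊ := by
      intro d m hd hm hdm
      have hd' : u ^ 40 / l ^ 2 < (d : ℝ) := hDlt.trans_le (by exact_mod_cast hd)
      have hm' : u ^ 40 / l ^ 2 < (m : ℝ) := hDlt.trans_le (by exact_mod_cast hm)
      have h1 : (m : ℝ) * d ^ 2 ≤ u ^ 120 := le_trans (by exact_mod_cast hdm) hNX
      constructor
      · refine Nat.le_floor ?_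
        by_contra! h
        have h2 : u ^ 40 / l ^ 2 * (u ^ 40 * l) ^ 2 < (m : ℝ) * d ^ 2 := by gcongr
        have h3 : u ^ 40 / l ^ 2 * (u ^ 40 * l) ^ 2 = u ^ 120 := by field_simp
        linarith
      · refine Nat.le_floor ?_
        by_contra! h
        have h2 : u ^ 40 * l ^ 4 * (u ^ 40 / l ^ 2) ^ 2 < (m : ℝ) * d ^ 2 := by gcongr
        have h3 : u ^ 40 * l ^ 4 * (u ^ 40 / l ^ 2) ^ 2 = u ^ 120 := by field_simp
        linarith
    have hDle' : (D : ℝ) ≤ u ^ 40 := hDle.trans (div_le_self (by positivity) (one_le_pow₀ hl1))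
    have hK : ∀ α : ZMod q, α ≠ 0 → (largeSquareCount q N D α : ℝ) ≤
        (2 + |C|) * (u ^ 40 / l ^ 2) + 4 * (u ^ 100 / q) := by
      intro α hα
      have h1 := largeSquareCount_le hα key
      have h2 := hC u l hu18 hl1 hX4 hlog q hq hqu α hα
      have h3 : C * (u ^ 40 / l ^ 2) ≤ |C| * (u ^ 40 / l ^ 2) := by gcongr; exact le_abs_self C
      linarith [hsqrt D hDle']
    have h1 := abs_progressionError_le X q D _ hK ha0
    nlinarith [abs_nonneg C]

theorem moebiusSq_mem (n : ℕ) : 0 ≤ moebiusSq n ∧ moebiusSq n ≤ 1 := by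
  refine ⟨sq_nonneg _, ?_⟩
  rw [moebiusSq, ← Int.cast_pow, ArithmeticFunction.moebius_sq]
  split_ifs <;> norm_num

theorem abs_progressionError_le_self {X : ℝ} (hX : 0 ≤ X) {q : ℕ} (hq : q.Prime) (a : ℤ) :
    |progressionError moebiusSq X q a| ≤ X := by
  have hsum : ∀ (P : ℕ → Prop) [DecidablePred P],
      0 ≤ ∑ n ∈ (Finset.Icc 1 ⌊X⌋₊).filter P, moebiusSq n ∧
        ∑ n ∈ (Finset.Icc 1 ⌊X⌋₊).filter P, moebiusSq n ≤ X := by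
    intro P _
    refine ⟨Finset.sum_nonneg fun n _ => (moebiusSq_mem n).1, ?_⟩
    calc ∑ n ∈ (Finset.Icc 1 ⌊X⌋₊).filter P, moebiusSq n
        ≤ ∑ n ∈ (Finset.Icc 1 ⌊X⌋₊).filter P, (1 : ℝ) := Finset.sum_le_sum fun n _ => (moebiusSq_mem n).2
      _ ≤ ∑ n ∈ Finset.Icc 1 ⌊X⌋₊, (1 : ℝ) :=
        Finset.sum_le_sum_of_subset_of_nonneg (Finset.filter_subset _ _) fun _ _ _ => by norm_num
      _ = ⌊X⌋₊ := by simp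
      _ ≤ X := Nat.floor_le hX
  have hφ : (1 : ℝ) ≤ q.totient := by exact_mod_cast Nat.totient_pos.2 hq.pos
  have h1 := hsum (fun n : ℕ => (n : ℤ) ≡ a [ZMOD (q : ℤ)])
  have h2 := hsum (fun n : ℕ => Nat.Coprime n q)
  have h3 : 1 / (q.totient : ℝ) ≤ 1 := by rw [div_le_one (by linarith)]; exact hφ
  have h4 : 0 ≤ 1 / (q.totient : ℝ) := by positivity
  rw [progressionError, progressionSum, coprimeAverage, abs_le]
  constructor <;> nlinarith

/-- For 3 < X ≤ X₁ the trivial bound by X ≤ X₁ suffices, the first term of the bound being at least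
1. -/
theorem exists_abs_progressionError_le :
    ∃ C : ℝ, 0 ≤ C ∧ ∀ X : ℝ, 3 < X → ∀ q : ℕ, q.Prime → ∀ a : ℤ, IsCoprime a (q : ℤ) →
      |progressionError moebiusSq X q a| ≤
        C * (X ^ (1 / 3 : ℝ) / Real.log X ^ (1 / 6 : ℝ) + X ^ (5 / 6 : ℝ) / q) := by
  obtain ⟨C, X₁, hC0, hX₁, hC⟩ := exists_abs_progressionError_le_of_large
  refine ⟨C + X₁, by linarith, ?_⟩
  intro X hX q hq a ha
  have hX0 : 0 < X := by linarith
  have hq0 : (0 : ℝ) < q := by exact_mod_cast hq.pos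
  have hlog : 0 < Real.log X := Real.log_pos (by linarith)
  have h0 : 0 ≤ X ^ (5 / 6 : ℝ) / q := by positivity
  have h0' : 0 ≤ X ^ (1 / 3 : ℝ) / Real.log X ^ (1 / 6 : ℝ) := by positivity
  rcases le_total X₁ X with h | h
  · refine (hC X h q hq a ha).trans ?_
    gcongr
    linarith
  · refine (abs_progressionError_le_self hX0.le hq a).trans ?_
    have h1 : 1 ≤ X ^ (1 / 3 : ℝ) / Real.log X ^ (1 / 6 : ℝ) := by
      rw [one_le_div (by positivity)]
      calc Real.log X ^ (1 / 6 : ℝ) ≤ X ^ (1 / 6 : ℝ) :=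
            Real.rpow_le_rpow hlog.le ((Real.log_le_sub_one_of_pos hX0).trans (by linarith)) (by norm_num)
        _ ≤ X ^ (1 / 3 : ℝ) := Real.rpow_le_rpow_of_exponent_le (by linarith) (by norm_num)
    nlinarith

/-! ### The main term -/

/-- The terms of the Dirichlet series of `μ` at `2` restricted to the integers coprime to `q`. -/
noncomputable def coprimeMoebiusTerm (q d : ℕ) : ℝ :=
  if Nat.Coprime d q then ((μ d : ℤ) : ℝ) / (d : ℝ) ^ 2 else 0

/-- The series is the inverse of L(2,χ₀), which is ζ(2) without its Euler factor at q. -/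
theorem hasSum_coprimeMoebiusTerm {q : ℕ} (hq : q.Prime) :
    HasSum (coprimeMoebiusTerm q) (6 / Real.pi ^ 2 * (1 - 1 / (q : ℝ) ^ 2)⁻¹) := by
  have := Fact.mk hq
  let χ : DirichletCharacter ℂ q := 1
  have hs : 1 < (2 : ℂ).re := by norm_num
  have h1 := DirichletCharacter.LSeries.mul_mu_eq_one χ hs
  have h2 : LSeries (χ ·) 2 = (1 - 1 / (q : ℂ) ^ 2) * (Real.pi ^ 2 / 6) := by
    rw [← DirichletCharacter.LFunction_eq_LSeries χ hs]
    have h := DirichletCharacter.LFunctionTrivChar_eq_mul_riemannZeta (N := q) (s := 2) (by norm_num)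
    rw [hq.primeFactors, Finset.prod_singleton, riemannZeta_two] at h
    rw [show DirichletCharacter.LFunction χ 2 = DirichletCharacter.LFunctionTrivChar q 2 from rfl, h,
      Complex.cpow_neg, one_div]
    norm_cast
  have h3 : LSeriesSummable ((fun n : ℕ => χ n) * fun n : ℕ => ((μ n : ℤ) : ℂ)) 2 :=
    DirichletCharacter.LSeriesSummable_mul χ
      (ArithmeticFunction.LSeriesSummable_moebius_iff.mpr hs)
  have h4 := h3.hasSum
  change HasSum _ (LSeries _ 2) at h4
  rw [← Complex.hasSum_ofReal]
  convert h4 using 1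
  · funext d
    rcases eq_or_ne d 0 with rfl | hd
    · simp [coprimeMoebiusTerm]
    · rw [LSeries.term_of_ne_zero hd, Pi.mul_apply, coprimeMoebiusTerm]
      have : ((d : ℂ)) ^ (2 : ℂ) = (d : ℂ) ^ 2 := by norm_cast
      rw [this]
      split_ifs with h
      · rw [MulChar.one_apply ((ZMod.isUnit_iff_coprime d q).2 h)]
        push_cast
        ring
      · rw [MulChar.map_nonunit _ (fun hu => h ((ZMod.isUnit_iff_coprime d q).1 hu))]
        simp
  · rw [h2] at h1
    have h5 := eq_inv_of_mul_eq_one_right h1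
    rw [h5, mul_inv, inv_div]
    push_cast
    ring

theorem abs_coprimeMoebiusTerm_le (q d : ℕ) : |coprimeMoebiusTerm q d| ≤ ((d : ℝ) ^ 2)⁻¹ := by
  rw [coprimeMoebiusTerm]
  split_ifs
  · rw [abs_div, abs_of_nonneg (by positivity : (0 : ℝ) ≤ (d : ℝ) ^ 2), div_eq_mul_inv]
    refine mul_le_of_le_one_left (by positivity) ?_
    exact_mod_cast ArithmeticFunction.abs_moebius_le_one (n := d)
  · rw [abs_zero]; positivity

theorem abs_sum_coprimeMoebiusTerm_sub_le {q : ℕ} (hq : q.Prime) (R : ℕ) :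
    |(∑ d ∈ Finset.Icc 1 R, coprimeMoebiusTerm q d) - 6 / Real.pi ^ 2 * (1 - 1 / (q : ℝ) ^ 2)⁻¹| ≤
      2 / ((R : ℝ) + 1) := by
  have ht := (hasSum_coprimeMoebiusTerm hq).tendsto_sum_nat
  have h0 : ∑ d ∈ Finset.Icc 1 R, coprimeMoebiusTerm q d = ∑ d ∈ Finset.range (R + 1), coprimeMoebiusTerm q d := by
    refine Finset.sum_subset (fun d hd => ?_) fun d hd hd' => ?_
    · rw [Finset.mem_Icc] at hd
      exact Finset.mem_range.2 (by omega)
    · rw [Finset.mem_range] at hd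
      rw [Finset.mem_Icc] at hd'
      obtain rfl : d = 0 := by omega
      simp [coprimeMoebiusTerm]
  rw [abs_sub_comm]
  refine le_of_tendsto ((ht.sub_const _).abs) (Filter.eventually_atTop.2 ⟨R + 1, fun n hn => ?_⟩)
  rw [h0, ← Finset.sum_Ico_eq_sub _ hn]
  refine (Finset.abs_sum_le_sum_abs _ _).trans ?_
  refine (Finset.sum_le_sum fun d _ => abs_coprimeMoebiusTerm_le q d).trans ?_
  exact sum_Ioo_inv_sq_le R n

theorem card_coprime_multiples (q N d : ℕ) (hd : 1 ≤ d) (hq : q.Prime) :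
    (((Finset.Icc 1 N).filter (fun n => Nat.Coprime n q)).filter (fun n => d ^ 2 ∣ n)).card =
      if Nat.Coprime d q then N / d ^ 2 - N / d ^ 2 / q else 0 := by
  have hd2 : 0 < d ^ 2 := by positivity
  split_ifs with h
  · have h1 : (((Finset.Icc 1 N).filter (fun n => Nat.Coprime n q)).filter (fun n => d ^ 2 ∣ n)).card =
        ((Finset.Ioc 0 (N / d ^ 2)).filter (fun m => ¬ q ∣ m)).card := by
      refine (Finset.card_bij (fun m _ => m * d ^ 2) ?_ ?_ ?_).symm
      · intro m hm
        simp only [Finset.mem_filter, Finset.mem_Ioc, Finset.mem_Icc] at hm ⊢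
        refine ⟨⟨⟨Nat.mul_pos hm.1.1 hd2, (Nat.le_div_iff_mul_le hd2).1 hm.1.2⟩, ?_⟩,
          Dvd.intro_left _ rfl⟩
        exact Nat.Coprime.mul_left (Nat.coprime_comm.1 ((hq.coprime_iff_not_dvd).2 hm.2))
          (Nat.Coprime.pow_left 2 h)
      · intro m _ m' _ h
        exact Nat.eq_of_mul_eq_mul_right hd2 h
      · intro n hn
        simp only [Finset.mem_filter, Finset.mem_Icc] at hn
        obtain ⟨⟨⟨hn1, hn2⟩, hn3⟩, m, rfl⟩ := hn
        refine ⟨m, ?_, mul_comm _ _⟩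
        simp only [Finset.mem_filter, Finset.mem_Ioc]
        refine ⟨⟨Nat.pos_of_mul_pos_left hn1, ?_⟩, ?_⟩
        · rw [Nat.le_div_iff_mul_le hd2, mul_comm]; exact hn2
        · exact (hq.coprime_iff_not_dvd).1 (Nat.coprime_comm.1 (Nat.Coprime.coprime_dvd_left (Dvd.intro_left _ rfl) hn3))
    rw [h1, Finset.filter_not, Finset.card_sdiff_of_subset (Finset.filter_subset _ _),
      Nat.Ioc_filter_dvd_card_eq_div, Nat.card_Ioc, Nat.sub_zero]
  · rw [Finset.card_eq_zero, Finset.filter_eq_empty_iff]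
    intro n hn hdn
    refine h (Nat.Coprime.coprime_dvd_left ?_ (Finset.mem_filter.1 hn).2)
    exact (Dvd.intro_left _ (by rw [sq])).trans hdn

/-- Only d ≤ √X matter. Each costs a rounding error of at most 1, and completing the series costs
X·O(1/√X). -/
theorem abs_coprime_sum_sub_le {X : ℝ} (hX : 1 ≤ X) {q : ℕ} (hq : q.Prime) :
    |(∑ n ∈ (Finset.Icc 1 ⌊X⌋₊).filter (fun n : ℕ => Nat.Coprime n q), moebiusSq n) -
      X * (1 - 1 / (q : ℝ)) * (6 / Real.pi ^ 2 * (1 - 1 / (q : ℝ) ^ 2)⁻¹)| ≤ 3 * Real.sqrt X := by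
  have hX0 : 0 ≤ X := by linarith
  have hq1 : (1 : ℝ) < q := by exact_mod_cast hq.one_lt
  have hq0 : (0 : ℝ) < q := by linarith
  have hqi : 0 ≤ 1 - 1 / (q : ℝ) ∧ 1 - 1 / (q : ℝ) ≤ 1 := by
    have h1 : 1 / (q : ℝ) ≤ 1 := by rw [div_le_one hq0]; exact hq1.le
    have h2 : 0 ≤ 1 / (q : ℝ) := by positivity
    constructor <;> linarith
  set N := ⌊X⌋₊ with hN
  set R := ⌊Real.sqrt X⌋₊ with hR
  have hsq := Real.sq_sqrt hX0
  have hsq1 : 1 ≤ Real.sqrt X := Real.one_le_sqrt.2 hX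
  have hRle : (R : ℝ) ≤ Real.sqrt X := Nat.floor_le (Real.sqrt_nonneg X)
  have hRlt : Real.sqrt X < R + 1 := Nat.lt_floor_add_one _
  have hRN : R ≤ N := Nat.floor_le_floor (by nlinarith)
  have hsum : (∑ n ∈ (Finset.Icc 1 N).filter (fun n : ℕ => Nat.Coprime n q), moebiusSq n) =
      ∑ d ∈ Finset.Icc 1 R, ((μ d : ℤ) : ℝ) *
        ((if Nat.Coprime d q then N / d ^ 2 - N / d ^ 2 / q else 0 : ℕ) : ℝ) := by
    have h1 : (∑ n ∈ (Finset.Icc 1 N).filter (fun n : ℕ => Nat.Coprime n q), moebiusSq n) =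
        ∑ n ∈ (Finset.Icc 1 N).filter (fun n : ℕ => Nat.Coprime n q),
          ∑ d ∈ Finset.Icc 1 N, if d ^ 2 ∣ n then ((μ d : ℤ) : ℝ) else 0 := by
      refine Finset.sum_congr rfl fun n hn => ?_
      have hn' := Finset.mem_Icc.1 (Finset.mem_filter.1 hn).1
      rw [moebiusSq_eq_sum hn'.1 hn'.2, Finset.sum_filter]
    rw [h1, Finset.sum_comm]
    symm
    have h2 : ∀ d ∈ Finset.Icc 1 N, (∑ n ∈ (Finset.Icc 1 N).filter (fun n : ℕ => Nat.Coprime n q),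
        if d ^ 2 ∣ n then ((μ d : ℤ) : ℝ) else 0) = ((μ d : ℤ) : ℝ) *
        ((if Nat.Coprime d q then N / d ^ 2 - N / d ^ 2 / q else 0 : ℕ) : ℝ) := by
      intro d hd
      rw [← Finset.sum_filter, Finset.sum_const, nsmul_eq_mul, mul_comm,
        card_coprime_multiples q N d (Finset.mem_Icc.1 hd).1 hq]
    rw [Finset.sum_congr rfl h2]
    refine Finset.sum_subset (Finset.Icc_subset_Icc_right hRN) fun d hd hd' => ?_
    rw [Finset.mem_Icc] at hd hd'
    have h3 : R + 1 ≤ d := by omega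
    have h4 : N < d ^ 2 := by
      have h5 : (R : ℝ) + 1 ≤ d := by exact_mod_cast h3
      have h6 : (N : ℝ) ≤ X := Nat.floor_le hX0
      have h7 : X < (d : ℝ) ^ 2 := by nlinarith
      exact_mod_cast h6.trans_lt h7
    simp [Nat.div_eq_of_lt h4]
  have hterm : ∀ d ∈ Finset.Icc 1 R, |((μ d : ℤ) : ℝ) *
        ((if Nat.Coprime d q then N / d ^ 2 - N / d ^ 2 / q else 0 : ℕ) : ℝ) -
        X * (1 - 1 / (q : ℝ)) * coprimeMoebiusTerm q d| ≤ 1 := by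
    intro d hd
    have hd0 : (0 : ℝ) < d := by exact_mod_cast (Finset.mem_Icc.1 hd).1
    rw [coprimeMoebiusTerm]
    split_ifs
    · have hY1 : ((N / d ^ 2 : ℕ) : ℝ) ≤ X / d ^ 2 := by
        refine Nat.cast_div_le.trans ?_
        push_cast
        gcongr
        exact Nat.floor_le hX0
      have hY2 : X / d ^ 2 < ((N / d ^ 2 : ℕ) : ℝ) + 1 := by
        have := Nat.lt_floor_add_one (X / ((d ^ 2 : ℕ) : ℝ))
        rw [Nat.floor_div_natCast] at this
        push_cast at this ⊢
        exact this
      generalize N / d ^ 2 = Y at *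
      have hYq1 : ((Y / q : ℕ) : ℝ) ≤ Y / q := Nat.cast_div_le
      have hYq2 : (Y : ℝ) / q < ((Y / q : ℕ) : ℝ) + 1 := by
        have := Nat.lt_floor_add_one ((Y : ℝ) / q)
        rwa [Nat.floor_div_natCast, Nat.floor_natCast] at this
      rw [Nat.cast_sub (Nat.div_le_self _ _)]
      have h1 : ((μ d : ℤ) : ℝ) * ((Y : ℝ) - ((Y / q : ℕ) : ℝ)) -
          X * (1 - 1 / (q : ℝ)) * (((μ d : ℤ) : ℝ) / (d : ℝ) ^ 2) = ((μ d : ℤ) : ℝ) *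
          (((Y : ℝ) - X / d ^ 2) * (1 - 1 / q) + (Y / q - ((Y / q : ℕ) : ℝ))) := by ring
      have hμ : |((μ d : ℤ) : ℝ)| ≤ 1 := by
        exact_mod_cast ArithmeticFunction.abs_moebius_le_one (n := d)
      rw [h1, abs_mul]
      refine mul_le_one₀ hμ (abs_nonneg _) ?_
      -- The two rounding errors have opposite signs: the first lies in [−1, 0], the second in [0,
      -- 1], so their sum is bounded by 1 rather than 2.
      rw [abs_le]
      constructor <;> nlinarith
    · simp
  have h1 : |(∑ d ∈ Finset.Icc 1 R, ((μ d : ℤ) : ℝ) *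
        ((if Nat.Coprime d q then N / d ^ 2 - N / d ^ 2 / q else 0 : ℕ) : ℝ)) -
        X * (1 - 1 / (q : ℝ)) * ∑ d ∈ Finset.Icc 1 R, coprimeMoebiusTerm q d| ≤ Real.sqrt X := by
    rw [Finset.mul_sum, ← Finset.sum_sub_distrib]
    refine (Finset.abs_sum_le_sum_abs _ _).trans ((Finset.sum_le_sum hterm).trans ?_)
    simpa using hRle
  have h2 : |X * (1 - 1 / (q : ℝ)) * (∑ d ∈ Finset.Icc 1 R, coprimeMoebiusTerm q d) -
      X * (1 - 1 / (q : ℝ)) * (6 / Real.pi ^ 2 * (1 - 1 / (q : ℝ) ^ 2)⁻¹)| ≤ 2 * Real.sqrt X := by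
    rw [← mul_sub, abs_mul, abs_of_nonneg (mul_nonneg hX0 hqi.1)]
    calc X * (1 - 1 / (q : ℝ)) * _ ≤ X * 1 * (2 / (R + 1)) := by
          gcongr
          · exact hqi.2
          · exact abs_sum_coprimeMoebiusTerm_sub_le hq R
      _ ≤ X * 1 * (2 / Real.sqrt X) := by gcongr
      _ = 2 * Real.sqrt X := by
          have : Real.sqrt X ≠ 0 := by positivity
          field_simp
          exact hsq.symm
  rw [hsum]
  refine (abs_sub_le _ _ _).trans ((add_le_add h1 h2).trans (le_of_eq (by ring)))

theorem abs_coprimeAverage_sub_le {X : ℝ} (hX : 1 ≤ X) {q : ℕ} (hq : q.Prime) :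
    |coprimeAverage moebiusSq X q - 6 / Real.pi ^ 2 * (1 - 1 / (q : ℝ) ^ 2)⁻¹ * (X / (q : ℝ))| ≤
      6 * Real.sqrt X / q := by
  have hq2 : (2 : ℝ) ≤ q := by exact_mod_cast hq.two_le
  have hφ : (q.totient : ℝ) = q - 1 := by
    rw [Nat.totient_prime hq, Nat.cast_sub hq.one_lt.le, Nat.cast_one]
  have hq1 : (0 : ℝ) < q - 1 := by linarith
  have h := abs_coprime_sum_sub_le hX hq
  rw [coprimeAverage, hφ]
  set A := ∑ n ∈ (Finset.Icc 1 ⌊X⌋₊).filter (fun n : ℕ => Nat.Coprime n q), moebiusSq n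
  set G := 6 / Real.pi ^ 2 * (1 - 1 / (q : ℝ) ^ 2)⁻¹
  have h1 : 1 / ((q : ℝ) - 1) * A - G * (X / q) = (A - X * (1 - 1 / q) * G) / (q - 1) := by
    field_simp
  rw [h1, abs_div, abs_of_pos hq1, div_le_div_iff₀ hq1 (by linarith)]
  nlinarith [Real.sqrt_nonneg X]

/-! ### Deduction of the two statements -/

theorem moebiusSq_error_bound {γ : ℝ} (hγ : 0 < γ) (hγ' : γ < 1 / 2) :
    ∃ C : ℝ, ∀ X : ℝ, 3 < X → ∀ q : ℕ, q.Prime → ∀ a : ℤ, IsCoprime a (q : ℤ) →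
        |progressionError moebiusSq X q a| ≤
          C * (X ^ (1 / 3 : ℝ) * Real.log (Real.log X) ^ (7 / 3 : ℝ)
                  / Real.log X ^ (1 / 6 - γ / 3 : ℝ)
                + X * Real.log (Real.log X) ^ 2
                  / ((q : ℝ) * Real.log X ^ (γ / 2 : ℝ))) := by
  obtain ⟨C, hC0, hC⟩ := exists_abs_progressionError_le
  have hl3 : 1 < Real.log 3 := by
    rw [Real.lt_log_iff_exp_lt (by norm_num)]
    linarith [Real.exp_one_lt_d9]
  -- A positive lower bound for log log X on X > 3, which absorbs the powers of log log X into the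
  -- constant.
  set k := Real.log (Real.log 3) with hk
  have hk0 : 0 < k := Real.log_pos hl3
  refine ⟨C * (1 / k ^ (7 / 3 : ℝ) + 6 / k ^ 2), ?_⟩
  intro X hX q hq a ha
  refine (hC X hX q hq a ha).trans ?_
  rw [mul_assoc]
  refine mul_le_mul_of_nonneg_left ?_ hC0
  have hX0 : 0 < X := by linarith
  have hq0 : (0 : ℝ) < q := by exact_mod_cast hq.pos
  have hL : Real.log 3 ≤ Real.log X := Real.log_le_log (by norm_num) hX.le
  have hL1 : 1 ≤ Real.log X := by linarith
  have hL0 : 0 < Real.log X := by linarith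
  have hkL : k ≤ Real.log (Real.log X) := Real.log_le_log (by linarith) hL
  have hLL0 : 0 < Real.log (Real.log X) := by linarith
  have hP : 0 ≤ X ^ (1 / 3 : ℝ) * Real.log (Real.log X) ^ (7 / 3 : ℝ)
      / Real.log X ^ (1 / 6 - γ / 3 : ℝ) := by positivity
  have hQ : 0 ≤ X * Real.log (Real.log X) ^ 2 / ((q : ℝ) * Real.log X ^ (γ / 2 : ℝ)) := by positivity
  have h1 : X ^ (1 / 3 : ℝ) / Real.log X ^ (1 / 6 : ℝ) ≤
      1 / k ^ (7 / 3 : ℝ) * (X ^ (1 / 3 : ℝ) * Real.log (Real.log X) ^ (7 / 3 : ℝ)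
      / Real.log X ^ (1 / 6 - γ / 3 : ℝ)) := by
    have e1 : k ^ (7 / 3 : ℝ) ≤ Real.log (Real.log X) ^ (7 / 3 : ℝ) :=
      Real.rpow_le_rpow hk0.le hkL (by norm_num)
    have e2 : Real.log X ^ (1 / 6 - γ / 3 : ℝ) ≤ Real.log X ^ (1 / 6 : ℝ) :=
      Real.rpow_le_rpow_of_exponent_le hL1 (by linarith)
    have e3 : 0 < k ^ (7 / 3 : ℝ) := by positivity
    calc X ^ (1 / 3 : ℝ) / Real.log X ^ (1 / 6 : ℝ)
        = 1 / k ^ (7 / 3 : ℝ) * (X ^ (1 / 3 : ℝ) * k ^ (7 / 3 : ℝ) / Real.log X ^ (1 / 6 : ℝ)) := by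
          field_simp
      _ ≤ _ := by gcongr
  have h2 : X ^ (5 / 6 : ℝ) / q ≤
      6 / k ^ 2 * (X * Real.log (Real.log X) ^ 2 / ((q : ℝ) * Real.log X ^ (γ / 2 : ℝ))) := by
    have e1 : Real.log X ^ (γ / 2 : ℝ) ≤ 6 * X ^ (1 / 6 : ℝ) := by
      calc Real.log X ^ (γ / 2 : ℝ) ≤ Real.log X ^ (1 : ℝ) :=
            Real.rpow_le_rpow_of_exponent_le hL1 (by linarith)
        _ = Real.log X := Real.rpow_one _
        _ ≤ X ^ (1 / 6 : ℝ) / (1 / 6) := Real.log_le_rpow_div hX0.le (by norm_num)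
        _ = 6 * X ^ (1 / 6 : ℝ) := by ring
    have e2 : X = X ^ (5 / 6 : ℝ) * X ^ (1 / 6 : ℝ) := by
      rw [← Real.rpow_add hX0]; norm_num
    calc X ^ (5 / 6 : ℝ) / q = 6 / k ^ 2 * ((X ^ (5 / 6 : ℝ) * X ^ (1 / 6 : ℝ)) * k ^ 2 /
          (q * (6 * X ^ (1 / 6 : ℝ)))) := by
          field_simp
      _ = 6 / k ^ 2 * (X * k ^ 2 / (q * (6 * X ^ (1 / 6 : ℝ)))) := by rw [← e2]
      _ ≤ _ := by gcongr
  have h3 : 0 ≤ 1 / k ^ (7 / 3 : ℝ) := by positivity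
  have h4 : 0 ≤ 6 / k ^ 2 := by positivity
  nlinarith [mul_nonneg h3 hQ, mul_nonneg h4 hP]

/-- Relative to X/q, the range of q turns the first error term into (log X)^(−ε), and the second is
X^(−1/6) for every q. -/
theorem moebiusSq_asymptotics {ε : ℝ} (hε : 0 < ε) {δ : ℝ} (hδ : 0 < δ) :
    ∃ X₀ : ℝ, 3 < X₀ ∧ ∀ X : ℝ, X₀ ≤ X → ∀ q : ℕ, q.Prime →
        (q : ℝ) ≤ X ^ (2 / 3 : ℝ) * Real.log X ^ (1 / 6 - ε : ℝ) →
        ∀ a : ℤ, IsCoprime a (q : ℤ) →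
          |progressionSum moebiusSq X q a - coprimeAverage moebiusSq X q|
              ≤ δ * coprimeAverage moebiusSq X q ∧
          |coprimeAverage moebiusSq X q
              - 6 / Real.pi ^ 2 * (1 - 1 / (q : ℝ) ^ 2)⁻¹ * (X / (q : ℝ))|
              ≤ δ * (6 / Real.pi ^ 2 * (1 - 1 / (q : ℝ) ^ 2)⁻¹ * (X / (q : ℝ))) := by
  obtain ⟨C, hC0, hC⟩ := exists_abs_progressionError_le
  have ht1 : Filter.Tendsto (fun X : ℝ => C * (Real.log X ^ (-ε) + X ^ (-(1 / 6) : ℝ)))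
      Filter.atTop (nhds 0) := by
    have e1 := (tendsto_rpow_neg_atTop hε).comp Real.tendsto_log_atTop
    have e2 := tendsto_rpow_neg_atTop (by norm_num : (0 : ℝ) < 1 / 6)
    simpa using (e1.add e2).const_mul C
  have ht2 : Filter.Tendsto (fun X : ℝ => 6 * X ^ (-(1 / 2) : ℝ)) Filter.atTop (nhds 0) := by
    simpa using (tendsto_rpow_neg_atTop (by norm_num : (0 : ℝ) < 1 / 2)).const_mul 6
  -- The main term is at least X/(2q). An error of at most X/(4q) keeps S₀ ≥ X/(4q), which matches
  -- the threshold δ/4; the threshold δ/2 matches the main term itself.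
  have hev := (ht1.eventually (gt_mem_nhds (by positivity : 0 < δ / 4))).and
    (ht2.eventually (gt_mem_nhds (by positivity : 0 < min (1 / 4) (δ / 2))))
  obtain ⟨X₁, hX₁⟩ := Filter.eventually_atTop.1 hev
  refine ⟨max X₁ 4, lt_max_of_lt_right (by norm_num), ?_⟩
  intro X hX q hq hqX a ha
  obtain ⟨h1, h2⟩ := hX₁ X ((le_max_left _ _).trans hX)
  have hX4 : 4 ≤ X := (le_max_right _ _).trans hX
  have hX0 : 0 < X := by linarith
  have hq2 : (2 : ℝ) ≤ q := by exact_mod_cast hq.two_le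
  have hq0 : (0 : ℝ) < q := by linarith
  have hL0 : 0 < Real.log X := Real.log_pos (by linarith)
  have hXq : 0 < X / q := by positivity
  set A := 6 / Real.pi ^ 2 * (1 - 1 / (q : ℝ) ^ 2)⁻¹ * (X / (q : ℝ)) with hA
  have hAge : X / q * (1 / 2) ≤ A := by
    have hpi : (1 : ℝ) / 2 ≤ 6 / Real.pi ^ 2 := by
      rw [div_le_div_iff₀ (by norm_num) (by positivity)]
      nlinarith [Real.pi_lt_d2, Real.pi_pos]
    have hinv : 1 ≤ (1 - 1 / (q : ℝ) ^ 2)⁻¹ := by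
      have e1 : 1 / (q : ℝ) ^ 2 < 1 := by
        rw [div_lt_one (by positivity)]
        nlinarith
      have e2 : 0 ≤ 1 / (q : ℝ) ^ 2 := by positivity
      exact (one_le_inv₀ (by linarith)).2 (by linarith)
    calc X / q * (1 / 2) = 1 / 2 * 1 * (X / q) := by ring
      _ ≤ A := by rw [hA]; gcongr
  have hS0 := abs_coprimeAverage_sub_le (by linarith : 1 ≤ X) hq
  rw [← hA] at hS0
  have hsq : 6 * Real.sqrt X / q = X / q * (6 * X ^ (-(1 / 2) : ℝ)) := by
    have : Real.sqrt X = X * X ^ (-(1 / 2) : ℝ) := by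
      rw [Real.sqrt_eq_rpow]
      nth_rewrite 2 [← Real.rpow_one X]
      rw [← Real.rpow_add hX0]; norm_num
    rw [this]; ring
  rw [hsq] at hS0
  have h3 : X / q * (6 * X ^ (-(1 / 2) : ℝ)) ≤ X / q * (1 / 4) :=
    mul_le_mul_of_nonneg_left (h2.le.trans (min_le_left _ _)) hXq.le
  have h4 : X / q * (6 * X ^ (-(1 / 2) : ℝ)) ≤ X / q * (δ / 2) :=
    mul_le_mul_of_nonneg_left (h2.le.trans (min_le_right _ _)) hXq.le
  have hS0ge : X / q * (1 / 4) ≤ coprimeAverage moebiusSq X q := by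
    have := (abs_le.1 hS0).1
    linarith
  refine ⟨?_, ?_⟩
  · have h5 := hC X (by linarith) q hq a ha
    rw [progressionError] at h5
    have h6 : X ^ (1 / 3 : ℝ) / Real.log X ^ (1 / 6 : ℝ) ≤ X / q * Real.log X ^ (-ε) := by
      rw [div_mul_eq_mul_div, div_le_div_iff₀ (by positivity) hq0]
      calc X ^ (1 / 3 : ℝ) * q ≤ X ^ (1 / 3 : ℝ) * (X ^ (2 / 3 : ℝ) * Real.log X ^ (1 / 6 - ε : ℝ)) := by
            gcongr
        _ = X ^ (1 / 3 + 2 / 3 : ℝ) * Real.log X ^ (-ε + 1 / 6 : ℝ) := by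
            rw [Real.rpow_add hX0, ← mul_assoc, show 1 / 6 - ε = -ε + 1 / 6 by ring]
        _ = X * Real.log X ^ (-ε) * Real.log X ^ (1 / 6 : ℝ) := by
            rw [Real.rpow_add hL0, show (1 / 3 + 2 / 3 : ℝ) = 1 by norm_num, Real.rpow_one, mul_assoc]
    have h7 : X ^ (5 / 6 : ℝ) / q = X / q * X ^ (-(1 / 6) : ℝ) := by
      have : X ^ (5 / 6 : ℝ) = X * X ^ (-(1 / 6) : ℝ) := by
        nth_rewrite 2 [← Real.rpow_one X]
        rw [← Real.rpow_add hX0]; norm_num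
      rw [this]; ring
    calc |progressionSum moebiusSq X q a - coprimeAverage moebiusSq X q|
        ≤ C * (X / q * Real.log X ^ (-ε) + X / q * X ^ (-(1 / 6) : ℝ)) := by
          refine h5.trans ?_
          rw [h7]
          gcongr
      _ = X / q * (C * (Real.log X ^ (-ε) + X ^ (-(1 / 6) : ℝ))) := by ring
      _ ≤ X / q * (δ / 4) := by gcongr
      _ = δ * (X / q * (1 / 4)) := by ring
      _ ≤ δ * coprimeAverage moebiusSq X q := by gcongr
  · refine hS0.trans (h4.trans ?_)
    calc X / q * (δ / 2) = δ * (X / q * (1 / 2)) := by ring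
      _ ≤ δ * A := by gcongr

theorem theorem3 :
    -- the upper bound for the error term
    (∀ γ : ℝ, 0 < γ → γ < 1 / 2 →
      ∃ C : ℝ, ∀ X : ℝ, 3 < X → ∀ q : ℕ, q.Prime → ∀ a : ℤ, IsCoprime a (q : ℤ) →
        |progressionError moebiusSq X q a| ≤
          C * (X ^ (1 / 3 : ℝ) * Real.log (Real.log X) ^ (7 / 3 : ℝ)
                  / Real.log X ^ (1 / 6 - γ / 3 : ℝ)
                + X * Real.log (Real.log X) ^ 2
                  / ((q : ℝ) * Real.log X ^ (γ / 2 : ℝ)))) ∧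
    -- the asymptotic formulas, uniformly in the modulus and in the residue class
    (∀ ε : ℝ, 0 < ε → ∀ δ : ℝ, 0 < δ →
      ∃ X₀ : ℝ, 3 < X₀ ∧ ∀ X : ℝ, X₀ ≤ X → ∀ q : ℕ, q.Prime →
        (q : ℝ) ≤ X ^ (2 / 3 : ℝ) * Real.log X ^ (1 / 6 - ε : ℝ) →
        ∀ a : ℤ, IsCoprime a (q : ℤ) →
          |progressionSum moebiusSq X q a - coprimeAverage moebiusSq X q|
              ≤ δ * coprimeAverage moebiusSq X q ∧
          |coprimeAverage moebiusSq X q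
              - 6 / Real.pi ^ 2 * (1 - 1 / (q : ℝ) ^ 2)⁻¹ * (X / (q : ℝ))|
              ≤ δ * (6 / Real.pi ^ 2 * (1 - 1 / (q : ℝ) ^ 2)⁻¹ * (X / (q : ℝ)))) := by
  exact ⟨fun _ hγ hγ' => moebiusSq_error_bound hγ hγ',
    fun _ hε _ hδ => moebiusSq_asymptotics hε hδ⟩
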